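/- Setting. Let $\Gamma=(\mathbb Z_2)^n$ with the scalar product $\langle\gamma,\delta\rangle=\sum_i\gamma_i\delta_i\in\mathbb Z_2$; call $\gamma$ even (odd) if $\langle\gamma,\gamma\rangle=0$ (resp. $=1$). Let $A=\bigoplus_{\gamma\in\Gamma}A^\gamma$ be an associative unital $\Gamma$-graded real algebra that is graded commutative: $ba=(-1)^{\langle\gamma,\delta\rangle}ab$ for $a\in A^\gamma$, $b\in A^\delta$. Let $N\ge 0$ and let $A[\varepsilon]$ be the algebra of polynomials with coefficients in $A$ in a formal central parameter $\varepsilon$ of degree $0$ with $\varepsilon^N=0$, graded by $A[\varepsilon]^\gamma=\sum_k A^\gamma\varepsilon^k$. Order the elements of $\Gamma$ in any way in which the even ones precede the odd ones, and let $\mathbf r=(r_\gamma)_{\gamma\in\Gamma}\in\mathbb N^{\Gamma}$. For a graded commutative algebra $B$, $\mathsf M^0(\mathbf r;B)$ is the set of block matrices $X=(X_{\gamma\delta})_{\gamma,\delta\in\Gamma}$, with $X_{\gamma\delta}$ of size $r_\gamma\times r_\delta$ and with entries in $B^{\gamma+\delta}$, and $\mathsf{GL}^0(\mathbf r;B)$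 is the group of its invertible elements. Write $X=\begin{pmatrix}\mathcal X_{11}&\mathcal X_{12}\\ \mathcal X_{21}&\mathcal X_{22}\end{pmatrix}$ for the decomposition of $X$ according to even and odd degrees. The graded trace is $\Gamma\mathrm{tr}(X)=\sum_\gamma(-1)^{\langle\gamma,\gamma\rangle}\operatorname{tr}(X_{\gamma\gamma})$. For a block matrix $Y=(Y_{ij})_{1\le i,j\le q}$ of degree $0$ whose block degrees are all even, or all odd, the graded determinant is $$\Gamma\mathrm{det}(Y)=\prod_{k=1}^{q}\det\big(Y_{kk}-Y_{k,>k}\,(Y_{>k,>k})^{-1}\,Y_{>k,k}\big),$$ where the subscript $>k$ collects the blocks with index larger than $k$, whenever the inverses exist. The graded Berezinian is $$\Gamma\mathrm{ber}(X)=\Gamma\mathrm{det}\big(\mathcal X_{11}-\mathcal X_{12}\mathcal X_{22}^{-1}\mathcal X_{21}\big)\cdot\Gamma\mathrm{det}(\mathcal X_{22})^{-1}$$ whenever these expressions exist. These two notions are characterized as follows. (D) $\Gamma\mathrm{det}$ maps the degree $0$ block matrices of the given block sizes to $B^0$, is multiplicative, equals $\prod_k\det(Y_{kk})$ on block-diagonal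 matrices and $1$ on upper and on lower block-unitriangular matrices. (B) $\Gamma\mathrm{ber}$ is a group homomorphism $\mathsf{GL}^0(\mathbf r;B)\to(B^0)^\times$ that equals $\Gamma\mathrm{det}(\mathcal X_{11})\,\Gamma\mathrm{det}(\mathcal X_{22})^{-1}$ if $\mathcal X_{12}=0$ and $\mathcal X_{21}=0$, and equals $1$ on upper and on lower $2\times2$ block-unitriangular matrices. Theorem 6.1 (graded Liouville formula). Let $X\in\mathsf M^0(\mathbf r;A)$ be a graded matrix of degree $0$, and put $\exp(\varepsilon X)=\sum_{k<N}\varepsilon^kX^k/k!$. Then $\exp(\varepsilon X)\in\mathsf{GL}^0(\mathbf r;A[\varepsilon])$, all inverses in the formulas above for $\Gamma\mathrm{ber}(\exp(\varepsilon X))$ exist, and $$\Gamma\mathrm{ber}(\exp(\varepsilon X))=\exp(\Gamma\mathrm{tr}(\varepsilon X)),$$ where $\exp(\Gamma\mathrm{tr}(\varepsilon X))=\sum_{k<N}\varepsilon^k\,\Gamma\mathrm{tr}(X)^k/k!$. The same equality holds for every map $\Gamma\mathrm{ber}$ on $\mathsf{GL}^0(\mathbf r;A[\varepsilon])$ with the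 properties (B), formed with any maps $\Gamma\mathrm{det}$ with the properties (D) on the even and on the odd part. -/

import Mathlib

open scoped Polynomial Nat

noncomputable section

namespace GradedLiouville

/-! ### The grading group and graded commutative algebras -/

/-- The grading group `(ℤ/2)ⁿ`. -/
abbrev Deg (n : ℕ) : Type := Fin n → ZMod 2

/-- The standard scalar product on `(ℤ/2)ⁿ` with values in `ℤ/2`. -/
def sp {n : ℕ} (γ δ : Deg n) : ZMod 2 := ∑ i, γ i * δ i

/-- The sign `(-1)^s` for `s` in `ℤ/2`. -/
def sgn (s : ZMod 2) : ℤ := if s = 0 then 1 else -1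

/-- The even elements of `(ℤ/2)ⁿ`. -/
abbrev EvenDeg (n : ℕ) : Type := {γ : Deg n // sp γ γ = 0}

/-- The odd elements of `(ℤ/2)ⁿ`. -/
abbrev OddDeg (n : ℕ) : Type := {γ : Deg n // sp γ γ = 1}

/-- Graded commutativity: `b a = (-1)^⟨deg a, deg b⟩ a b` for homogeneous `a`, `b`. -/
def IsGradedCommutative {n : ℕ} {A : Type*} [Ring A] [Algebra ℝ A]
    (𝒜 : Deg n → Submodule ℝ A) : Prop :=
  ∀ γ δ : Deg n, ∀ a ∈ 𝒜 γ, ∀ b ∈ 𝒜 δ, b * a = sgn (sp γ δ) • (a * b)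

/-! ### Block matrices

`K` is the set of block labels and block `k` has size `r k`. -/

/-- Row and column indices of a block matrix. -/
abbrev BIdx {K : Type*} (r : K → ℕ) : Type _ := Σ k : K, Fin (r k)

/-- `X` is a homogeneous graded matrix of degree `x`: the entries of the block `(k, u)` have degree
`-γ_k + γ_u + x`, where `γ_k = w k` is the degree attached to the label `k`. -/
def IsHomogeneousMatrix {n : ℕ} {B : Type*} [Ring B] [Algebra ℝ B] (ℬ : Deg n → Submodule ℝ B)
    {K : Type*} (w : K → Deg n) {r : K → ℕ} (x : Deg n)
    (X : Matrix (BIdx r) (BIdx r) B) : Prop :=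
  ∀ i j, X i j ∈ ℬ (-w i.1 + w j.1 + x)

/-- `X` is an invertible graded matrix of degree `0`. -/
def IsGL0 {n : ℕ} {B : Type*} [Ring B] [Algebra ℝ B] (ℬ : Deg n → Submodule ℝ B)
    {r : Deg n → ℕ} (X : Matrix (BIdx r) (BIdx r) B) : Prop :=
  IsHomogeneousMatrix ℬ id 0 X ∧ IsUnit X

/-- The inclusion of the indices of the block with label `k`. -/
def blockIdx {K : Type*} (r : K → ℕ) (k : K) (a : Fin (r k)) : BIdx r := ⟨k, a⟩

/-- The diagonal block with label `k`. -/
def diagBlock {B : Type*} {K : Type*} {r : K → ℕ} (X : Matrix (BIdx r) (BIdx r) B) (k : K) :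
    Matrix (Fin (r k)) (Fin (r k)) B :=
  X.submatrix (blockIdx r k) (blockIdx r k)

/-- The principal block submatrix on the set of labels `T`. -/
def principal {B : Type*} {K : Type*} {r : K → ℕ} (X : Matrix (BIdx r) (BIdx r) B)
    (T : Finset K) : Matrix {i : BIdx r // i.1 ∈ T} {i : BIdx r // i.1 ∈ T} B :=
  X.submatrix Subtype.val Subtype.val

/-- The graded trace of a homogeneous matrix of degree `x`:
`∑ₖ (-1)^⟨γₖ + x, γₖ⟩ tr Xₖₖ`. -/
def gtr {n : ℕ} {B : Type*} [Ring B] {r : Deg n → ℕ} (x : Deg n)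
    (X : Matrix (BIdx r) (BIdx r) B) : B :=
  ∑ γ : Deg n, sgn (sp (γ + x) γ) • (diagBlock X γ).trace

/-- The usual determinant, as the Leibniz sum. It is applied to matrices whose entries have degree
`0` and so commute with each other; the ring itself need not be commutative. -/
def blockDet {B : Type*} [Ring B] {m : ℕ} (M : Matrix (Fin m) (Fin m) B) : B :=
  ∑ σ : Equiv.Perm (Fin m), (Equiv.Perm.sign σ : ℤ) • (List.ofFn fun i => M (σ i) i).prod

/-- The block quasideterminant `|X_{S,S}|_{kk}`, where `S = {k} ∪ T`:
`X_{kk} - X_{k,T} (X_{T,T})⁻¹ X_{T,k}`. It is meaningful if `X_{T,T}` is invertible. -/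
def quasidet {B : Type*} [Ring B] {K : Type*} [Fintype K] [DecidableEq K] {r : K → ℕ}
    (X : Matrix (BIdx r) (BIdx r) B) (k : K) (T : Finset K) : Matrix (Fin (r k)) (Fin (r k)) B :=
  diagBlock X k -
    X.submatrix (blockIdx r k) (Subtype.val : {i : BIdx r // i.1 ∈ T} → BIdx r) *
      Ring.inverse (principal X T) *
      X.submatrix (Subtype.val : {i : BIdx r // i.1 ∈ T} → BIdx r) (blockIdx r k)

/-- For block labels listed as `k₁, …, k_q`: the principal block submatrices `X_{T,T}`,
`T = {k_{i+1}, …, k_q}`, are invertible, so that all quasideterminants in `gdet` exist. -/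
def GdetDefined {B : Type*} [Ring B] {K : Type*} [Fintype K] [DecidableEq K] {r : K → ℕ} :
    List K → Matrix (BIdx r) (BIdx r) B → Prop
  | [], _ => True
  | _ :: t, X => IsUnit (principal X t.toFinset) ∧ GdetDefined t X

/-- The graded determinant: if the block labels are listed as `1, …, q`, it is the product
`det |X|₁₁ · det |X^{1,1}|₂₂ · det |X^{12,12}|₃₃ ⋯ det X_{qq}`. -/
def gdet {B : Type*} [Ring B] {K : Type*} [Fintype K] [DecidableEq K] {r : K → ℕ} :
    List K → Matrix (BIdx r) (BIdx r) B → B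
  | [], _ => 1
  | k :: t, X => blockDet (quasidet X k t.toFinset) * gdet t X

/-! ### The decomposition into even and odd blocks, and the graded Berezinian -/

section TwoByTwo

variable {n : ℕ} {B : Type*} {r : Deg n → ℕ}

/-- The inclusion of the even indices. -/
def evenIdx (r : Deg n → ℕ) (i : BIdx fun γ : EvenDeg n => r γ) : BIdx r := ⟨i.1.1, i.2⟩

/-- The inclusion of the odd indices. -/
def oddIdx (r : Deg n → ℕ) (i : BIdx fun γ : OddDeg n => r γ) : BIdx r := ⟨i.1.1, i.2⟩

/-- The even-even block. -/
def block11 (X : Matrix (BIdx r) (BIdx r) B) :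
    Matrix (BIdx fun γ : EvenDeg n => r γ) (BIdx fun γ : EvenDeg n => r γ) B :=
  X.submatrix (evenIdx r) (evenIdx r)

/-- The even-odd block. -/
def block12 (X : Matrix (BIdx r) (BIdx r) B) :
    Matrix (BIdx fun γ : EvenDeg n => r γ) (BIdx fun γ : OddDeg n => r γ) B :=
  X.submatrix (evenIdx r) (oddIdx r)

/-- The odd-even block. -/
def block21 (X : Matrix (BIdx r) (BIdx r) B) :
    Matrix (BIdx fun γ : OddDeg n => r γ) (BIdx fun γ : EvenDeg n => r γ) B :=
  X.submatrix (oddIdx r) (evenIdx r)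

/-- The odd-odd block. -/
def block22 (X : Matrix (BIdx r) (BIdx r) B) :
    Matrix (BIdx fun γ : OddDeg n => r γ) (BIdx fun γ : OddDeg n => r γ) B :=
  X.submatrix (oddIdx r) (oddIdx r)

/-- The quasideterminant `|X|₁₁ = X₁₁ - X₁₂ X₂₂⁻¹ X₂₁` of the even-odd decomposition. -/
def quasidet11 [Ring B] (X : Matrix (BIdx r) (BIdx r) B) :
    Matrix (BIdx fun γ : EvenDeg n => r γ) (BIdx fun γ : EvenDeg n => r γ) B :=
  block11 X - block12 X * Ring.inverse (block22 X) * block21 X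

/-- All inverses and quasideterminants that occur in `gber` exist. -/
def GberDefined [Ring B] (l₀ : List (EvenDeg n)) (l₁ : List (OddDeg n))
    (X : Matrix (BIdx r) (BIdx r) B) : Prop :=
  IsUnit (block22 X) ∧ GdetDefined l₀ (quasidet11 X) ∧ GdetDefined l₁ (block22 X) ∧
    IsUnit (gdet l₁ (block22 X))

/-- The graded Berezinian `gdet |X|₁₁ · (gdet X₂₂)⁻¹`. The lists `l₀` and `l₁` are the orderings
of the even and of the odd degrees. -/
def gber [Ring B] (l₀ : List (EvenDeg n)) (l₁ : List (OddDeg n))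
    (X : Matrix (BIdx r) (BIdx r) B) : B :=
  gdet l₀ (quasidet11 X) * Ring.inverse (gdet l₁ (block22 X))

end TwoByTwo

/-! ### The characterizing properties of the graded determinant and of the graded Berezinian -/

/-- All diagonal blocks of `X` are identity matrices. -/
def HasUnitDiagBlocks {B : Type*} [Ring B] {K : Type*} {r : K → ℕ}
    (X : Matrix (BIdx r) (BIdx r) B) : Prop :=
  ∀ k, diagBlock X k = 1

/-- The properties that characterize the graded determinant on degree `0` matrices whose block
labels, listed in the order `l`, have the degrees `w k`: it takes values of degree `0`, is
multiplicative, is the product of the determinants of the blocks on block-diagonal matrices, and is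
`1` on block-unitriangular matrices. -/
structure IsGradedDeterminant {n : ℕ} {B : Type*} [Ring B] [Algebra ℝ B]
    (ℬ : Deg n → Submodule ℝ B) {K : Type*} [Fintype K] [DecidableEq K] (w : K → Deg n)
    {r : K → ℕ} (l : List K) (D : Matrix (BIdx r) (BIdx r) B → B) : Prop where
  mem : ∀ X, IsHomogeneousMatrix ℬ w 0 X → D X ∈ ℬ 0
  mul : ∀ X Y, IsHomogeneousMatrix ℬ w 0 X → IsHomogeneousMatrix ℬ w 0 Y → D (X * Y) = D X * D Y
  diag : ∀ X, IsHomogeneousMatrix ℬ w 0 X → (∀ i j, i.1 ≠ j.1 → X i j = 0) →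
    D X = (l.map fun k => blockDet (diagBlock X k)).prod
  upper : ∀ X, IsHomogeneousMatrix ℬ w 0 X → HasUnitDiagBlocks X →
    X.BlockTriangular (fun i => l.idxOf i.1) → D X = 1
  lower : ∀ X, IsHomogeneousMatrix ℬ w 0 X → HasUnitDiagBlocks X →
    X.transpose.BlockTriangular (fun i => l.idxOf i.1) → D X = 1

/-- The properties that characterize the graded Berezinian: on invertible matrices of degree `0` it
is a homomorphism into the group of units of the degree `0` subalgebra, it is
`D₀ X₁₁ · (D₁ X₂₂)⁻¹` on even-odd block-diagonal matrices, with `D₀`, `D₁` the graded determinants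
of the even and of the odd part, and it is `1` on even-odd block-unitriangular matrices. -/
structure IsGradedBerezinian {n : ℕ} {B : Type*} [Ring B] [Algebra ℝ B]
    (ℬ : Deg n → Submodule ℝ B) {r : Deg n → ℕ}
    (D₀ : Matrix (BIdx fun γ : EvenDeg n => r γ) (BIdx fun γ : EvenDeg n => r γ) B → B)
    (D₁ : Matrix (BIdx fun γ : OddDeg n => r γ) (BIdx fun γ : OddDeg n => r γ) B → B)
    (Ber : Matrix (BIdx r) (BIdx r) B → B) : Prop where
  mem : ∀ X, IsGL0 ℬ X → Ber X ∈ ℬ 0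
  isUnit : ∀ X, IsGL0 ℬ X → IsUnit (Ber X)
  mul : ∀ X Y, IsGL0 ℬ X → IsGL0 ℬ Y → Ber (X * Y) = Ber X * Ber Y
  diag : ∀ X, IsGL0 ℬ X → block12 X = 0 → block21 X = 0 →
    Ber X = D₀ (block11 X) * Ring.inverse (D₁ (block22 X))
  upper : ∀ X, IsGL0 ℬ X → block11 X = 1 → block22 X = 1 → block21 X = 0 → Ber X = 1
  lower : ∀ X, IsGL0 ℬ X → block11 X = 1 → block22 X = 1 → block12 X = 0 → Ber X = 1

/-! ### The algebra `A[ε]` with a formal nilpotent parameter, and exponentials -/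

instance span_X_pow_isTwoSided (A : Type*) [Ring A] (N : ℕ) :
    (Ideal.span {(Polynomial.X : A[X]) ^ N}).IsTwoSided where
  mul_mem_of_left := by
    intro a b ha
    obtain ⟨c, rfl⟩ := Ideal.mem_span_singleton'.1 ha
    refine Ideal.mem_span_singleton'.2 ⟨c * b, ?_⟩
    rw [mul_assoc, mul_assoc, (Polynomial.commute_X_pow b N).eq]

/-- `A[ε]`: polynomials in a central parameter `ε` with coefficients in `A`, where `ε ^ N = 0`. -/
abbrev NilPoly (A : Type*) [Ring A] (N : ℕ) : Type _ :=
  A[X] ⧸ Ideal.span {(Polynomial.X : A[X]) ^ N}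

section NilPoly

variable {A : Type*} [Ring A] (N : ℕ)

/-- The formal parameter `ε`. -/
def eps : NilPoly A N := Ideal.Quotient.mk _ Polynomial.X

/-- The inclusion of `A` into `A[ε]`. -/
def const : A →+* NilPoly A N := (Ideal.Quotient.mk _).comp Polynomial.C

/-- The grading of `A[ε]` in which `ε` has degree `0`: the component of degree `γ` consists of the
sums of elements `a εᵏ` with `a` of degree `γ`. -/
def epsGrading [Algebra ℝ A] {n : ℕ} (𝒜 : Deg n → Submodule ℝ A) (γ : Deg n) :
    Submodule ℝ (NilPoly A N) :=
  Submodule.span ℝ {b | ∃ a ∈ 𝒜 γ, ∃ k : ℕ, b = const N a * eps N ^ k}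

/-- The matrix `ε X` over `A[ε]`. -/
def epsMul {m : Type*} (X : Matrix m m A) : Matrix m m (NilPoly A N) :=
  (eps N : NilPoly A N) • X.map (const N)

end NilPoly

/-- The exponential series `∑ₖ bᵏ / k!` of an element with `b ^ N = 0`. -/
def nilExp {R : Type*} [Ring R] [Algebra ℝ R] (N : ℕ) (b : R) : R :=
  ∑ k ∈ Finset.range N, ((k ! : ℝ)⁻¹) • b ^ k

end GradedLiouville

end

/-!
# The graded Liouville formula

Let `θ = ε d/dε`, a derivation of degree `0` of `A[ε]`; unlike `d/dε`, it is compatible with the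
relation `ε ^ N = 0`. Put `E = exp (εX)`, so that `θ(E) = εX E`. The proof shows that the graded
Berezinian of `E` solves the linear differential equation `θ(f) = Γtr(εX) f` with constant term `1`.
The exponential of `Γtr(εX)` solves it too, and such a solution is unique, because the coefficient
of `ε ^ k` is multiplied by `k` under `θ` (`eq_of_euler_eq`).

The multiplicativity of the graded determinant is not needed for the differential equation. For a
unipotent matrix `M` of degree `0`, that is `M = 1 + εP`, consider the supertrace of the logarithmic
derivative, `ω(M) = Γtr(θ(M) M⁻¹)` (`logTr`). The graded trace is invariant under cyclic permutations
of matrices of degree `0` (`str_mul_comm`), hence `ω(M M') = ω(M) + ω(M')`, and `ω` vanishes on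
block-unitriangular matrices. The `UDL` decomposition then gives
`ω((a, b; c, d)) = ω(a - b d⁻¹ c) + ω(d)` (`logTr_fromBlocks`). Split off one block after another: the
quasideterminants in the definition of `gber` appear as the successive Schur complements, and
`ω(E)` is the sum of their contributions. The entries of these diagonal blocks have degree `0`, so
they are central, and Jacobi's formula applies to each block (`euler_blockDet`). The odd blocks count
with a minus sign in `ω` and with the exponent `-1` in `gber`, so that `θ(gber E) = ω(E) gber E`
(`euler_gber`), and `ω(E) = Γtr(εX)` as `θ(E) E⁻¹ = εX`.

Every map with the characterizing properties of the graded Berezinian has the same value on `E`,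
since these properties determine it on the factors of the `UDL` decompositions
(`IsGradedDeterminant.eq_gdet`, `IsGradedBerezinian.eq_gber`). All inverses exist, because each matrix
to be inverted is unipotent and its inverse is a finite geometric series.
-/

noncomputable section

namespace GradedLiouville

set_option linter.unusedSectionVars false

/-! ### Homogeneous rectangular matrices and the graded trace -/

lemma sgn_mul_sgn_add (a b : ZMod 2) : sgn b * sgn (a + b) = sgn a := by
  revert a b; decide

lemma deg_add_self {n : ℕ} (γ : Deg n) : γ + γ = 0 := by
  funext i
  exact CharTwo.add_self_eq_zero (γ i)

lemma deg_neg {n : ℕ} (γ : Deg n) : -γ = γ :=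
  neg_eq_of_add_eq_zero_left (deg_add_self γ)

lemma sp_add_add {n : ℕ} (γ δ : Deg n) : sp (γ + δ) (δ + γ) = sp γ γ + sp δ δ := by
  simp only [sp, ← Finset.sum_add_distrib]
  refine Finset.sum_congr rfl fun i _ => ?_
  have h : ∀ a b : ZMod 2, (a + b) * (b + a) = a * a + b * b := by decide
  exact h _ _

section Homogeneous

variable {n : ℕ} {R : Type*} [Ring R] [Algebra ℝ R] (ℬ : Deg n → Submodule ℝ R)
variable {ι κ μ ι' κ' : Type*}

/-- A rectangular matrix of degree `0`, with rows of degrees `w` and columns of degrees `v`. Degrees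
are their own negatives, so `w i + v j` stands for `-w i + v j`. -/
def IsHom (w : ι → Deg n) (v : κ → Deg n) (M : Matrix ι κ R) : Prop :=
  ∀ i j, M i j ∈ ℬ (w i + v j)

lemma isHomogeneousMatrix_iff {K : Type*} (w : K → Deg n) {r : K → ℕ}
    (X : Matrix (BIdx r) (BIdx r) R) :
    IsHomogeneousMatrix ℬ w 0 X ↔ IsHom ℬ (fun i => w i.1) (fun i => w i.1) X := by
  simp only [IsHomogeneousMatrix, IsHom, deg_neg, add_zero]

variable {ℬ} {w : ι → Deg n} {v : κ → Deg n} {u : μ → Deg n}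

lemma IsHom.zero : IsHom ℬ w v 0 := fun _ _ => zero_mem _

lemma IsHom.add {M M' : Matrix ι κ R} (h : IsHom ℬ w v M) (h' : IsHom ℬ w v M') :
    IsHom ℬ w v (M + M') := fun i j => add_mem (h i j) (h' i j)

lemma IsHom.neg {M : Matrix ι κ R} (h : IsHom ℬ w v M) : IsHom ℬ w v (-M) :=
  fun i j => neg_mem (h i j)

lemma IsHom.sub {M M' : Matrix ι κ R} (h : IsHom ℬ w v M) (h' : IsHom ℬ w v M') :
    IsHom ℬ w v (M - M') := fun i j => sub_mem (h i j) (h' i j)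

lemma IsHom.submatrix {M : Matrix ι κ R} (h : IsHom ℬ w v M) (f : ι' → ι) (g : κ' → κ) :
    IsHom ℬ (w ∘ f) (v ∘ g) (M.submatrix f g) := fun i j => h (f i) (g j)

lemma IsHom.sum {α : Type*} {s : Finset α} {M : α → Matrix ι κ R}
    (h : ∀ a ∈ s, IsHom ℬ w v (M a)) : IsHom ℬ w v (∑ a ∈ s, M a) := fun i j => by
  rw [Matrix.sum_apply]
  exact sum_mem fun a ha => h a ha i j

lemma IsHom.fromBlocks {w' : ι' → Deg n} {v' : κ' → Deg n} {a : Matrix ι κ R} {b : Matrix ι κ' R}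
    {c : Matrix ι' κ R} {d : Matrix ι' κ' R} (ha : IsHom ℬ w v a) (hb : IsHom ℬ w v' b)
    (hc : IsHom ℬ w' v c) (hd : IsHom ℬ w' v' d) :
    IsHom ℬ (Sum.elim w w') (Sum.elim v v') (Matrix.fromBlocks a b c d) := by
  rintro (i | i) (j | j)
  exacts [ha i j, hb i j, hc i j, hd i j]

section Graded

variable [SetLike.GradedMonoid ℬ]

lemma IsHom.one [DecidableEq ι] : IsHom ℬ w w (1 : Matrix ι ι R) := fun i j => by
  rcases eq_or_ne i j with rfl | h
  · rw [Matrix.one_apply_eq, deg_add_self]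
    exact SetLike.GradedOne.one_mem
  · rw [Matrix.one_apply_ne h]
    exact zero_mem _

lemma IsHom.mul [Fintype κ] {M : Matrix ι κ R} {M' : Matrix κ μ R} (h : IsHom ℬ w v M)
    (h' : IsHom ℬ v u M') : IsHom ℬ w u (M * M') := fun i j => by
  rw [Matrix.mul_apply]
  refine sum_mem fun k _ => ?_
  have := SetLike.GradedMul.mul_mem (h i k) (h' k j)
  rwa [add_assoc, ← add_assoc (v k), deg_add_self, zero_add] at this

lemma IsHom.pow [Fintype ι] [DecidableEq ι] {M : Matrix ι ι R} (h : IsHom ℬ w w M) (k : ℕ) :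
    IsHom ℬ w w (M ^ k) := by
  induction k with
  | zero => rw [pow_zero]; exact IsHom.one
  | succ k ih => rw [pow_succ]; exact ih.mul h

lemma IsHom.center_smul {ε : Subring.center R} (hε : (ε : R) ∈ ℬ 0) {M : Matrix ι κ R}
    (h : IsHom ℬ w v M) : IsHom ℬ w v (ε • M) := fun i j => by
  have := SetLike.GradedMul.mul_mem hε (h i j)
  rwa [zero_add] at this

end Graded

/-- The supertrace of a square matrix with rows and columns of degrees `w`: the graded trace in
degree `0`, for an arbitrary index type instead of block labels. -/
def str (w : ι → Deg n) [Fintype ι] (M : Matrix ι ι R) : R :=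
  ∑ i, sgn (sp (w i) (w i)) • M i i

variable [Fintype ι] [Fintype κ]

lemma str_add (M M' : Matrix ι ι R) : str w (M + M') = str w M + str w M' := by
  simp [str, Finset.sum_add_distrib]

lemma str_zero : str w (0 : Matrix ι ι R) = 0 := by simp [str]

lemma str_submatrix (e : κ ≃ ι) (M : Matrix ι ι R) :
    str (w ∘ e) (M.submatrix e e) = str w M :=
  Equiv.sum_comp e fun i => sgn (sp (w i) (w i)) • M i i

lemma str_fromBlocks (a : Matrix ι ι R) (b : Matrix ι κ R) (c : Matrix κ ι R)
    (d : Matrix κ κ R) :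
    str (Sum.elim w v) (Matrix.fromBlocks a b c d) = str w a + str v d := by
  simp [str]

/-- The supertrace of a matrix all of whose degrees have the same parity is a multiple of the
trace. -/
lemma str_eq_smul_trace {s : ZMod 2} (h : ∀ i, sp (w i) (w i) = s) (M : Matrix ι ι R) :
    str w M = sgn s • M.trace := by
  simp [str, h, Matrix.trace, Finset.smul_sum]

/-- Graded commutativity makes the supertrace invariant under cyclic permutations of matrices of
degree `0`: the sign from exchanging two entries of degree `γ + δ` is `(-1) ^ (⟨γ,γ⟩ + ⟨δ,δ⟩)`. -/
lemma str_mul_comm (hc : IsGradedCommutative ℬ) {P : Matrix ι κ R} {Q : Matrix κ ι R}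
    (hP : IsHom ℬ w v P) (hQ : IsHom ℬ v w Q) : str w (P * Q) = str v (Q * P) := by
  simp only [str, Matrix.mul_apply, Finset.smul_sum]
  rw [Finset.sum_comm]
  refine Finset.sum_congr rfl fun j _ => Finset.sum_congr rfl fun i _ => ?_
  rw [hc _ _ _ (hP i j) _ (hQ j i), smul_smul, sp_add_add, sgn_mul_sgn_add]

end Homogeneous

/-! ### Unipotent matrices -/

section Unipotent

variable {n : ℕ} {R : Type*} [Ring R] [Algebra ℝ R] (ℬ : Deg n → Submodule ℝ R)
variable {ι κ ι' : Type*}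

/-- The situation of `A[ε]`: the algebra is graded commutative, its elements of degree `0` are
central, and `ε` is a central nilpotent element of degree `0`. -/
structure IsNilpotentParameter (N : ℕ) (ε : Subring.center R) : Prop where
  comm : IsGradedCommutative ℬ
  central : ∀ z ∈ ℬ 0, z ∈ Subring.center R
  mem : (ε : R) ∈ ℬ 0
  pow_eq_zero : ε ^ N = 0

/-- Matrices of degree `0` that are congruent to the identity modulo `ε`. -/
def IsUnip (ε : Subring.center R) [DecidableEq ι] (w : ι → Deg n) (M : Matrix ι ι R) : Prop :=
  ∃ P, IsHom ℬ w w P ∧ M = 1 + ε • P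

variable {ℬ} {N : ℕ} {ε : Subring.center R} {w : ι → Deg n} {v : κ → Deg n}

lemma ringInverse_eq {S : Type*} [MonoidWithZero S] {a b : S} (h : a * b = 1) (h' : b * a = 1) :
    Ring.inverse a = b :=
  Ring.inverse_unit ⟨a, b, h, h'⟩

/-- The inverse of `1 + ε P` is the geometric series, which has the same form. -/
lemma exists_inverse_one_add {S : Type*} [Ring S] [Module (Subring.center R) S]
    [SMulCommClass (Subring.center R) S S] [IsScalarTower (Subring.center R) S S]
    (h : ε ^ N = 0) (P : S) :
    IsUnit (1 + ε • P) ∧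
      Ring.inverse (1 + ε • P) = 1 + ε • (-P * ∑ k ∈ Finset.range N, (-(ε • P)) ^ k) := by
  have hp : (-(ε • P)) ^ N = 0 := by
    rw [← smul_neg, smul_pow, h, zero_smul]
  have h1 := mul_neg_geom_sum (-(ε • P)) N
  have h2 := geom_sum_mul_neg (-(ε • P)) N
  rw [hp, sub_zero, sub_neg_eq_add] at h1 h2
  have h3 : (1 : S) + ε • (-P * ∑ k ∈ Finset.range N, (-(ε • P)) ^ k)
      = ∑ k ∈ Finset.range N, (-(ε • P)) ^ k := by
    rw [← smul_mul_assoc, smul_neg]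
    have : (1 : S) = (1 + ε • P) * ∑ k ∈ Finset.range N, (-(ε • P)) ^ k := h1.symm
    nth_rewrite 1 [this]
    noncomm_ring
  rw [h3]
  exact ⟨⟨⟨_, _, h1, h2⟩, rfl⟩, ringInverse_eq h1 h2⟩

section

variable [DecidableEq ι] [DecidableEq κ]

lemma IsUnip.one : IsUnip ℬ ε w (1 : Matrix ι ι R) := ⟨0, IsHom.zero, by simp⟩

lemma IsUnip.submatrix {M : Matrix ι ι R} (h : IsUnip ℬ ε w M) {f : κ → ι}
    (hf : Function.Injective f) : IsUnip ℬ ε (w ∘ f) (M.submatrix f f) := by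
  obtain ⟨P, hP, rfl⟩ := h
  refine ⟨P.submatrix f f, hP.submatrix f f, ?_⟩
  rw [← Matrix.submatrix_one f hf]
  rfl

/-- Off-diagonal submatrices of a unipotent matrix are divisible by `ε`. -/
lemma IsUnip.exists_offDiag {M : Matrix ι ι R} (h : IsUnip ℬ ε w M) {κ' : Type*} (f : κ → ι)
    (g : κ' → ι) (hfg : ∀ i j, f i ≠ g j) :
    ∃ P, IsHom ℬ (w ∘ f) (w ∘ g) P ∧ M.submatrix f g = ε • P := by
  obtain ⟨P, hP, rfl⟩ := h
  refine ⟨P.submatrix f g, hP.submatrix f g, ?_⟩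
  ext i j
  simp [Matrix.one_apply_ne (hfg i j)]

lemma IsUnip.fromBlocks {a : Matrix ι ι R} {b : Matrix ι κ R} {c : Matrix κ ι R}
    {d : Matrix κ κ R} (ha : IsUnip ℬ ε w a) (hb : IsHom ℬ w v b) (hc : IsHom ℬ v w c)
    (hd : IsUnip ℬ ε v d) :
    IsUnip ℬ ε (Sum.elim w v) (Matrix.fromBlocks a (ε • b) (ε • c) d) := by
  obtain ⟨P, hP, rfl⟩ := ha
  obtain ⟨Q, hQ, rfl⟩ := hd
  refine ⟨_, hP.fromBlocks hb hc hQ, ?_⟩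
  rw [← Matrix.fromBlocks_one, Matrix.fromBlocks_smul, Matrix.fromBlocks_add]
  simp

variable [SetLike.GradedMonoid ℬ]

lemma IsUnip.isHom (hε : IsNilpotentParameter ℬ N ε) {M : Matrix ι ι R} (h : IsUnip ℬ ε w M) :
    IsHom ℬ w w M := by
  obtain ⟨P, hP, rfl⟩ := h
  exact IsHom.one.add (hP.center_smul hε.mem)

variable [Fintype ι] [Fintype κ]

lemma IsUnip.mul (hε : IsNilpotentParameter ℬ N ε) {M M' : Matrix ι ι R} (h : IsUnip ℬ ε w M)
    (h' : IsUnip ℬ ε w M') : IsUnip ℬ ε w (M * M') := by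
  have h2 := h'.isHom hε
  obtain ⟨P, hP, rfl⟩ := h
  obtain ⟨P', hP', rfl⟩ := h'
  refine ⟨P' + P * (1 + ε • P'), hP'.add (hP.mul h2), ?_⟩
  simp only [smul_add, add_mul, mul_add, one_mul, mul_one, smul_mul_assoc]
  abel

lemma IsUnip.isUnit (hε : IsNilpotentParameter ℬ N ε) {M : Matrix ι ι R} (h : IsUnip ℬ ε w M) :
    IsUnit M := by
  obtain ⟨P, -, rfl⟩ := h
  exact (exists_inverse_one_add hε.pow_eq_zero P).1

lemma IsUnip.inverse (hε : IsNilpotentParameter ℬ N ε) {M : Matrix ι ι R} (h : IsUnip ℬ ε w M) :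
    IsUnip ℬ ε w (Ring.inverse M) := by
  obtain ⟨P, hP, rfl⟩ := h
  exact ⟨_, hP.neg.mul (IsHom.sum fun k _ => (hP.center_smul hε.mem).neg.pow k),
    (exists_inverse_one_add hε.pow_eq_zero P).2⟩

lemma IsUnip.mul_inverse (hε : IsNilpotentParameter ℬ N ε) {M : Matrix ι ι R}
    (h : IsUnip ℬ ε w M) : M * Ring.inverse M = 1 := Ring.mul_inverse_cancel _ (h.isUnit hε)

lemma IsUnip.inverse_mul (hε : IsNilpotentParameter ℬ N ε) {M : Matrix ι ι R}
    (h : IsUnip ℬ ε w M) : Ring.inverse M * M = 1 := Ring.inverse_mul_cancel _ (h.isUnit hε)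

/-- The Schur complement of a unipotent matrix is unipotent. -/
lemma IsUnip.schur (hε : IsNilpotentParameter ℬ N ε) {a : Matrix ι ι R} {b : Matrix ι κ R}
    {c : Matrix κ ι R} {d : Matrix κ κ R} (ha : IsUnip ℬ ε w a) (hb : IsHom ℬ w v b)
    (hc : IsHom ℬ v w c) (hd : IsUnip ℬ ε v d) :
    IsUnip ℬ ε w (a - (ε • b) * Ring.inverse d * (ε • c)) := by
  obtain ⟨P, hP, rfl⟩ := ha
  refine ⟨P - b * Ring.inverse d * (ε • c),
    hP.sub ((hb.mul ((hd.inverse hε).isHom hε)).mul (hc.center_smul hε.mem)), ?_⟩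
  rw [smul_sub, Matrix.smul_mul, Matrix.smul_mul]
  abel

end

/-- The `UDL` decomposition of a `2 × 2` block matrix over a possibly noncommutative ring. -/
lemma fromBlocks_eq_mul_mul [DecidableEq ι] [DecidableEq κ] [Fintype ι] [Fintype κ]
    (a : Matrix ι ι R) (b : Matrix ι κ R) (c : Matrix κ ι R) {d : Matrix κ κ R} (hd : IsUnit d) :
    Matrix.fromBlocks a b c d = Matrix.fromBlocks 1 (b * Ring.inverse d) 0 1 *
      Matrix.fromBlocks (a - b * Ring.inverse d * c) 0 0 d *
      Matrix.fromBlocks 1 0 (Ring.inverse d * c) 1 := by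
  have h1 := Ring.inverse_mul_cancel d hd
  have h2 := Ring.mul_inverse_cancel d hd
  simp [Matrix.fromBlocks_multiply, Matrix.mul_assoc, h1, ← Matrix.mul_assoc d, h2]

end Unipotent

/-! ### Jacobi's formula for derivations -/

section Jacobi

variable {C : Type*} [CommRing C] (δ : Derivation ℤ C C)

lemma derivation_prod {ι : Type*} [DecidableEq ι] (s : Finset ι) (f : ι → C) :
    δ (∏ i ∈ s, f i) = ∑ j ∈ s, δ (f j) * ∏ i ∈ s.erase j, f i := by
  induction s using Finset.induction_on with
  | empty => simp
  | insert a s ha ih =>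
    rw [Finset.prod_insert ha, δ.leibniz, ih, Finset.sum_insert ha, Finset.erase_insert ha,
      smul_eq_mul, smul_eq_mul, Finset.mul_sum, add_comm, mul_comm (δ (f a))]
    rw [mul_comm]
    congr 1
    refine Finset.sum_congr rfl fun j hj => ?_
    rw [Finset.erase_insert_of_ne (by rintro rfl; exact ha hj),
      Finset.prod_insert (fun h => ha (Finset.mem_of_mem_erase h))]
    ring

/-- Jacobi's formula. -/
lemma derivation_det {m : Type*} [Fintype m] [DecidableEq m] (M : Matrix m m C) :
    δ M.det = (M.map δ * M.adjugate).trace := by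
  rw [Matrix.trace_mul_comm, Matrix.trace, Matrix.det_apply, map_sum]
  have h : ∀ j, (M.adjugate * M.map δ).diag j = ∑ σ : Equiv.Perm m,
      Equiv.Perm.sign σ • (δ (M (σ j) j) * ∏ i ∈ Finset.univ.erase j, M (σ i) i) := by
    intro j
    have h1 : (M.adjugate * M.map δ).diag j = (M.updateCol j fun i => δ (M i j)).det := by
      rw [← Matrix.cramer_apply, Matrix.cramer_eq_adjugate_mulVec]
      rfl
    rw [h1, Matrix.det_apply]
    refine Finset.sum_congr rfl fun σ _ => ?_
    rw [← Finset.mul_prod_erase _ _ (Finset.mem_univ j), Matrix.updateCol_self]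
    congr 2
    refine Finset.prod_congr rfl fun i hi => ?_
    rw [Matrix.updateCol_ne (Finset.ne_of_mem_erase hi)]
  rw [Finset.sum_congr rfl fun j _ => h j, Finset.sum_comm]
  refine Finset.sum_congr rfl fun σ _ => ?_
  rw [← Finset.smul_sum, ← derivation_prod, Units.smul_def, Units.smul_def, map_zsmul]

end Jacobi

/-! ### Logarithmic derivatives -/

section Euler

variable {n : ℕ} {R : Type*} [Ring R] [Algebra ℝ R] (ℬ : Deg n → Submodule ℝ R)
variable {ι κ μ : Type*}

/-- The properties of the operator `ε d/dε` on `A[ε]`. Unlike `d/dε`, it is well defined when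
`ε ^ N = 0`. -/
structure IsEulerDerivation (ε : Subring.center R) (θ : R →ₗ[ℝ] R) : Prop where
  leibniz : ∀ a b, θ (a * b) = θ a * b + a * θ b
  hom : ∀ γ, ∀ a ∈ ℬ γ, θ a ∈ ℬ γ
  eps : θ ε = ε
  dvd : ∀ a, ∃ b, θ a = ε • b

variable {ℬ} {N : ℕ} {ε : Subring.center R} {θ : R →ₗ[ℝ] R} {w : ι → Deg n} {v : κ → Deg n}

lemma IsEulerDerivation.map_one (hθ : IsEulerDerivation ℬ ε θ) : θ 1 = 0 := by
  simpa using hθ.leibniz 1 1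

lemma IsEulerDerivation.mem_center (hθ : IsEulerDerivation ℬ ε θ) {z : R}
    (hz : z ∈ Subring.center R) : θ z ∈ Subring.center R := by
  rw [Subring.mem_center_iff] at hz ⊢
  intro a
  have h := congrArg θ (hz a)
  rw [hθ.leibniz, hθ.leibniz, hz (θ a), add_comm] at h
  exact add_right_cancel h

/-- A derivation maps the center to itself. -/
def IsEulerDerivation.centerDerivation (hθ : IsEulerDerivation ℬ ε θ) :
    Derivation ℤ (Subring.center R) (Subring.center R) :=
  Derivation.mk'
    { toFun := fun z => ⟨θ z, hθ.mem_center z.2⟩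
      map_add' := fun a b => Subtype.ext (map_add θ (a : R) b)
      map_smul' := fun k a => Subtype.ext (map_zsmul θ k (a : R)) }
    (fun a b => Subtype.ext (by
      change θ (a * b) = a * θ b + b * θ a
      rw [hθ.leibniz, add_comm, Subring.mem_center_iff.1 b.2 (θ a)]))

lemma IsEulerDerivation.coe_centerDerivation (hθ : IsEulerDerivation ℬ ε θ)
    (z : Subring.center R) : (hθ.centerDerivation z : R) = θ z := rfl

lemma IsEulerDerivation.map_matrix_mul (hθ : IsEulerDerivation ℬ ε θ) [Fintype κ]
    (M : Matrix ι κ R) (M' : Matrix κ μ R) :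
    (M * M').map θ = M.map θ * M' + M * M'.map θ := by
  ext i j
  simp [Matrix.mul_apply, hθ.leibniz, Finset.sum_add_distrib]

lemma IsEulerDerivation.map_matrix_one (hθ : IsEulerDerivation ℬ ε θ) [DecidableEq ι] :
    (1 : Matrix ι ι R).map θ = 0 := by
  ext i j
  rcases eq_or_ne i j with rfl | h
  · simp [hθ.map_one]
  · simp [Matrix.one_apply_ne h]

lemma IsHom.map_euler (hθ : IsEulerDerivation ℬ ε θ) {M : Matrix ι κ R} (h : IsHom ℬ w v M) :
    IsHom ℬ w v (M.map θ) := fun i j => hθ.hom _ _ (h i j)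

/-- The supertrace of the logarithmic derivative `θ(M) M⁻¹`. -/
def logTr (θ : R →ₗ[ℝ] R) [Fintype ι] [DecidableEq ι] (w : ι → Deg n) (M : Matrix ι ι R) : R :=
  str w (M.map θ * Ring.inverse M)

variable [Fintype ι] [DecidableEq ι] [Fintype κ] [DecidableEq κ]

lemma ringInverse_submatrix (e : κ ≃ ι) {M : Matrix ι ι R} (hM : IsUnit M) :
    Ring.inverse (M.submatrix e e) = (Ring.inverse M).submatrix e e := by
  apply ringInverse_eq
  · rw [Matrix.submatrix_mul_equiv, Ring.mul_inverse_cancel _ hM, Matrix.submatrix_one_equiv]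
  · rw [Matrix.submatrix_mul_equiv, Ring.inverse_mul_cancel _ hM, Matrix.submatrix_one_equiv]

lemma logTr_submatrix (e : κ ≃ ι) {M : Matrix ι ι R} (hM : IsUnit M) :
    logTr θ (w ∘ e) (M.submatrix e e) = logTr θ w M := by
  rw [logTr, ringInverse_submatrix e hM, ← Matrix.submatrix_map, Matrix.submatrix_mul_equiv,
    str_submatrix, logTr]

variable [SetLike.GradedMonoid ℬ]

/-- `logTr` is additive on products: `θ(M M') (M M')⁻¹ = θ(M) M⁻¹ + M (θ(M') M'⁻¹) M⁻¹`, and the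
supertrace is invariant under the conjugation by `M`. -/
lemma logTr_mul (hε : IsNilpotentParameter ℬ N ε) (hθ : IsEulerDerivation ℬ ε θ)
    {M M' : Matrix ι ι R} (h : IsUnip ℬ ε w M) (h' : IsUnip ℬ ε w M') :
    logTr θ w (M * M') = logTr θ w M + logTr θ w M' := by
  have hi : Ring.inverse (M * M') = Ring.inverse M' * Ring.inverse M := by
    apply ringInverse_eq
    · rw [mul_assoc, ← mul_assoc M', h'.mul_inverse hε, one_mul, h.mul_inverse hε]
    · rw [mul_assoc, ← mul_assoc _ M, h.inverse_mul hε, one_mul, h'.inverse_mul hε]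
  have h1 : (M * M').map θ * Ring.inverse (M * M') =
      M.map θ * Ring.inverse M + M * (M'.map θ * Ring.inverse M' * Ring.inverse M) := by
    rw [hi, hθ.map_matrix_mul, add_mul]
    congr 1
    · rw [mul_assoc, ← mul_assoc M', h'.mul_inverse hε, one_mul]
    · simp only [mul_assoc]
  have h2 := ((h'.isHom hε).map_euler hθ).mul ((h'.inverse hε).isHom hε)
  rw [logTr, h1, str_add, str_mul_comm hε.comm (h.isHom hε) (h2.mul ((h.inverse hε).isHom hε)),
    mul_assoc, h.inverse_mul hε, mul_one, logTr, logTr]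

lemma logTr_upper (hθ : IsEulerDerivation ℬ ε θ) (b : Matrix ι κ R) :
    logTr θ (Sum.elim w v) (Matrix.fromBlocks (1 : Matrix ι ι R) b 0 (1 : Matrix κ κ R)) = 0 := by
  have hi : Ring.inverse (Matrix.fromBlocks (1 : Matrix ι ι R) b 0 (1 : Matrix κ κ R)) =
      Matrix.fromBlocks 1 (-b) 0 1 := by
    apply ringInverse_eq <;> simp [Matrix.fromBlocks_multiply]
  rw [logTr, hi, Matrix.fromBlocks_map, Matrix.fromBlocks_multiply, str_fromBlocks,
    hθ.map_matrix_one, hθ.map_matrix_one, Matrix.map_zero _ (map_zero θ)]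
  simp [str_zero]

lemma logTr_lower (hθ : IsEulerDerivation ℬ ε θ) (c : Matrix κ ι R) :
    logTr θ (Sum.elim w v) (Matrix.fromBlocks (1 : Matrix ι ι R) 0 c (1 : Matrix κ κ R)) = 0 := by
  have hi : Ring.inverse (Matrix.fromBlocks (1 : Matrix ι ι R) 0 c (1 : Matrix κ κ R)) =
      Matrix.fromBlocks 1 0 (-c) 1 := by
    apply ringInverse_eq <;> simp [Matrix.fromBlocks_multiply]
  rw [logTr, hi, Matrix.fromBlocks_map, Matrix.fromBlocks_multiply, str_fromBlocks,
    hθ.map_matrix_one, hθ.map_matrix_one, Matrix.map_zero _ (map_zero θ)]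
  simp [str_zero]

lemma logTr_diag (hε : IsNilpotentParameter ℬ N ε) {a : Matrix ι ι R} {d : Matrix κ κ R}
    (ha : IsUnip ℬ ε w a) (hd : IsUnip ℬ ε v d) :
    logTr θ (Sum.elim w v) (Matrix.fromBlocks a 0 0 d) = logTr θ w a + logTr θ v d := by
  have hi : Ring.inverse (Matrix.fromBlocks a 0 0 d) =
      Matrix.fromBlocks (Ring.inverse a) 0 0 (Ring.inverse d) := by
    apply ringInverse_eq <;> simp [Matrix.fromBlocks_multiply, ha.mul_inverse hε,
      hd.mul_inverse hε, ha.inverse_mul hε, hd.inverse_mul hε]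
  rw [logTr, hi, Matrix.fromBlocks_map, Matrix.fromBlocks_multiply, str_fromBlocks, logTr, logTr]
  simp [Matrix.map_zero _ (map_zero θ)]

/-- The logarithmic derivative of a block matrix is the sum of those of its Schur complement and of
its lower right block: in the `UDL` decomposition the triangular factors contribute nothing. -/
lemma logTr_fromBlocks (hε : IsNilpotentParameter ℬ N ε) (hθ : IsEulerDerivation ℬ ε θ)
    {a : Matrix ι ι R} {b : Matrix ι κ R} {c : Matrix κ ι R} {d : Matrix κ κ R}
    (ha : IsUnip ℬ ε w a) (hb : IsHom ℬ w v b) (hc : IsHom ℬ v w c) (hd : IsUnip ℬ ε v d) :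
    logTr θ (Sum.elim w v) (Matrix.fromBlocks a (ε • b) (ε • c) d) =
      logTr θ w (a - (ε • b) * Ring.inverse d * (ε • c)) + logTr θ v d := by
  have hd' := (hd.inverse hε).isHom hε
  have hS := ha.schur hε hb hc hd
  have hU := (IsUnip.one (ℬ := ℬ) (ε := ε) (w := w)).fromBlocks (hb.mul hd') (IsHom.zero)
    (IsUnip.one (ε := ε) (w := v))
  have hL := (IsUnip.one (ℬ := ℬ) (ε := ε) (w := w)).fromBlocks IsHom.zero (hd'.mul hc)
    (IsUnip.one (ε := ε) (w := v))
  have hD := hS.fromBlocks (v := v) IsHom.zero IsHom.zero hd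
  rw [smul_zero, ← Matrix.smul_mul] at hU
  rw [smul_zero, ← Matrix.mul_smul] at hL
  rw [smul_zero, smul_zero] at hD
  rw [fromBlocks_eq_mul_mul _ _ _ (hd.isUnit hε), logTr_mul hε hθ (hU.mul hε hD) hL,
    logTr_mul hε hθ hU hD, logTr_upper hθ, logTr_lower hθ, logTr_diag hε hS hd, zero_add, add_zero]

end Euler

/-! ### Determinants of unipotent blocks -/

section BlockDet

variable {n : ℕ} {R : Type*} [Ring R] [Algebra ℝ R] {ℬ : Deg n → Submodule ℝ R}
variable {N : ℕ} {ε : Subring.center R} {θ : R →ₗ[ℝ] R}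

/-- Central elements that are congruent to `1` modulo `ε`. -/
def IsUnipCentral (ε : Subring.center R) (z : R) : Prop :=
  ∃ c : Subring.center R, z = ((1 + ε * c : Subring.center R) : R)

lemma IsUnipCentral.one : IsUnipCentral ε 1 := ⟨0, by simp⟩

lemma IsUnipCentral.mul {y z : R} (hy : IsUnipCentral ε y) (hz : IsUnipCentral ε z) :
    IsUnipCentral ε (y * z) := by
  obtain ⟨c, rfl⟩ := hy
  obtain ⟨c', rfl⟩ := hz
  exact ⟨c + c' + ε * c * c', by rw [← Subring.coe_mul]; congr 1; ring⟩

lemma IsUnipCentral.mem_center {z : R} (hz : IsUnipCentral ε z) : z ∈ Subring.center R := by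
  obtain ⟨c, rfl⟩ := hz
  exact (1 + ε * c : Subring.center R).2

lemma IsUnipCentral.isUnit (hε : ε ^ N = 0) {z : R} (hz : IsUnipCentral ε z) : IsUnit z := by
  obtain ⟨c, rfl⟩ := hz
  exact (exists_inverse_one_add hε c).1.map (Subring.center R).subtype

lemma IsUnipCentral.inverse (hε : ε ^ N = 0) {z : R} (hz : IsUnipCentral ε z) :
    IsUnipCentral ε (Ring.inverse z) := by
  obtain ⟨c, rfl⟩ := hz
  obtain ⟨h1, h2⟩ := exists_inverse_one_add hε c
  rw [smul_eq_mul, smul_eq_mul] at h2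
  rw [smul_eq_mul] at h1
  refine ⟨_, (ringInverse_eq (b := ((Ring.inverse (1 + ε * c) : Subring.center R) : R))
    ?_ ?_).trans (congrArg _ h2)⟩
  · rw [← Subring.coe_mul, Ring.mul_inverse_cancel _ h1, Subring.coe_one]
  · rw [← Subring.coe_mul, Ring.inverse_mul_cancel _ h1, Subring.coe_one]

lemma blockDet_map_subtype {m : ℕ} (M : Matrix (Fin m) (Fin m) (Subring.center R)) :
    blockDet (M.map (Subring.center R).subtype) = (M.det : R) := by
  change _ = (Subring.center R).subtype M.det
  rw [Matrix.det_apply, map_sum, blockDet]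
  refine Finset.sum_congr rfl fun σ _ => ?_
  rw [Units.smul_def, map_zsmul, ← List.prod_ofFn, map_list_prod, List.map_ofFn]
  rfl

variable [SetLike.GradedMonoid ℬ]

/-- The entries of a homogeneous block have degree `0`, hence are central. -/
lemma IsUnip.exists_central {m : ℕ} {w : Fin m → Deg n} {γ : Deg n} (hw : ∀ i, w i = γ)
    (hε : IsNilpotentParameter ℬ N ε) {M : Matrix (Fin m) (Fin m) R} (h : IsUnip ℬ ε w M) :
    ∃ P : Matrix (Fin m) (Fin m) (Subring.center R),
      M = (1 + ε • P).map (Subring.center R).subtype := by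
  obtain ⟨P, hP, rfl⟩ := h
  refine ⟨fun i j => ⟨P i j, hε.central _ ?_⟩, ?_⟩
  · have := hP i j
    rwa [hw, hw, deg_add_self] at this
  · ext i j
    rcases eq_or_ne i j with rfl | hij
    · simp; rfl
    · simp [Matrix.one_apply_ne hij]; rfl

lemma IsUnip.blockDet {m : ℕ} {w : Fin m → Deg n} {γ : Deg n} (hw : ∀ i, w i = γ)
    (hε : IsNilpotentParameter ℬ N ε) {M : Matrix (Fin m) (Fin m) R} (h : IsUnip ℬ ε w M) :
    IsUnipCentral ε (blockDet M) := by
  obtain ⟨P, rfl⟩ := h.exists_central hw hε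
  rw [blockDet_map_subtype, Matrix.det_one_add_smul]
  exact ⟨_, congrArg _ (by rw [pow_two, ← mul_assoc, mul_comm _ ε, mul_comm _ ε, add_assoc,
    ← mul_add])⟩

/-- Jacobi's formula for the determinant of a homogeneous block. -/
lemma euler_blockDet {m : ℕ} {w : Fin m → Deg n} {γ : Deg n} (hw : ∀ i, w i = γ)
    (hε : IsNilpotentParameter ℬ N ε) (hθ : IsEulerDerivation ℬ ε θ)
    {M : Matrix (Fin m) (Fin m) R} (h : IsUnip ℬ ε w M) :
    θ (GradedLiouville.blockDet M) =
      (M.map θ * Ring.inverse M).trace * GradedLiouville.blockDet M := by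
  obtain ⟨P, rfl⟩ := h.exists_central hw hε
  obtain ⟨Q, hQ⟩ := (h.inverse hε).exists_central hw hε
  set M' := 1 + ε • P
  set Q' := 1 + ε • Q
  have h1 := h.mul_inverse hε
  have hinj : Function.Injective fun M : Matrix (Fin m) (Fin m) (Subring.center R) =>
      M.map (Subring.center R).subtype := Matrix.map_injective Subtype.val_injective
  have h2 : M' * Q' = 1 := by
    apply hinj
    change (M' * Q').map _ = (1 : Matrix _ _ _).map _
    rw [Matrix.map_mul, ← hQ, h1]
    simp
  have h3 : M'.det • Q' = M'.adjugate := by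
    have := Matrix.adjugate_mul M'
    calc M'.det • Q' = (M'.adjugate * M') * Q' := by rw [this, Matrix.smul_mul, one_mul]
      _ = _ := by rw [mul_assoc, h2, mul_one]
  rw [blockDet_map_subtype, ← hθ.coe_centerDerivation, derivation_det, ← h3, Matrix.mul_smul,
    Matrix.trace_smul, smul_eq_mul, mul_comm, Subring.coe_mul, hQ]
  congr 1
  change (Subring.center R).subtype (Matrix.trace _) = _
  rw [AddMonoidHom.map_trace, Matrix.map_mul]
  rfl

end BlockDet

/-! ### The graded determinant of a unipotent matrix -/

section Gdet

variable {n : ℕ} {R : Type*} [Ring R] [Algebra ℝ R] {ℬ : Deg n → Submodule ℝ R}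
variable {N : ℕ} {ε : Subring.center R} {θ : R →ₗ[ℝ] R}
variable {K : Type*} [Fintype K] [DecidableEq K] {w : K → Deg n} {r : K → ℕ}

/-- The indices with labels in `{k} ∪ T` are those with label `k` and those with label in `T`. -/
def consEquiv (r : K → ℕ) {k : K} {T T' : Finset K} (hk : k ∉ T)
    (hT : ∀ x, x ∈ T' ↔ x = k ∨ x ∈ T) :
    Fin (r k) ⊕ {i : BIdx r // i.1 ∈ T} ≃ {i : BIdx r // i.1 ∈ T'} :=
  Equiv.ofBijective
    (Sum.elim (fun a => ⟨⟨k, a⟩, (hT k).2 (Or.inl rfl)⟩)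
      (fun i => ⟨i.1, (hT _).2 (Or.inr i.2)⟩)) <| by
    constructor
    · rintro (a | ⟨i, hi⟩) (b | ⟨j, hj⟩) h
      · simpa using h
      · simp only [Sum.elim_inl, Sum.elim_inr, Subtype.mk.injEq] at h
        subst h
        exact absurd hj hk
      · simp only [Sum.elim_inl, Sum.elim_inr, Subtype.mk.injEq] at h
        subst h
        exact absurd hi hk
      · simpa using h
    · rintro ⟨⟨x, a⟩, hx⟩
      rcases (hT x).1 hx with rfl | hx'
      · exact ⟨Sum.inl a, rfl⟩
      · exact ⟨Sum.inr ⟨⟨x, a⟩, hx'⟩, rfl⟩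

/-- The splitting of all indices into those with label `k`, those with label in `T`, and the
others. -/
def splitEquiv (r : K → ℕ) {k : K} {T : Finset K} (hk : k ∉ T) :
    (Fin (r k) ⊕ {i : BIdx r // i.1 ∈ T}) ⊕ {i : BIdx r // ¬ i.1 ∈ insert k T} ≃ BIdx r :=
  ((consEquiv r hk fun _ => Finset.mem_insert).sumCongr (Equiv.refl _)).trans
    (Equiv.sumCompl fun i : BIdx r => i.1 ∈ insert k T)

/-- The off-diagonal blocks of a unipotent matrix next to the block `k`. -/
lemma IsUnip.exists_blocks {Y : Matrix (BIdx r) (BIdx r) R}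
    (hY : IsUnip ℬ ε (fun i => w i.1) Y) {k : K} {T : Finset K} (hk : k ∉ T) :
    (∃ b, IsHom ℬ (fun _ : Fin (r k) => w k) (fun j : {i : BIdx r // i.1 ∈ T} => w j.1.1) b ∧
      Y.submatrix (blockIdx r k) Subtype.val = ε • b) ∧
    ∃ c, IsHom ℬ (fun j : {i : BIdx r // i.1 ∈ T} => w j.1.1) (fun _ : Fin (r k) => w k) c ∧
      Y.submatrix Subtype.val (blockIdx r k) = ε • c := by
  constructor
  · refine hY.exists_offDiag (blockIdx r k) (Subtype.val : {i : BIdx r // i.1 ∈ T} → _) ?_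
    rintro i ⟨j, hj⟩ rfl
    exact hk hj
  · refine hY.exists_offDiag (Subtype.val : {i : BIdx r // i.1 ∈ T} → _) (blockIdx r k) ?_
    rintro ⟨j, hj⟩ i rfl
    exact hk hj

lemma blockIdx_injective (k : K) : Function.Injective (blockIdx r k) :=
  fun _ _ h => by simpa [blockIdx] using h

lemma IsUnip.diagBlock {Y : Matrix (BIdx r) (BIdx r) R} (hY : IsUnip ℬ ε (fun i => w i.1) Y)
    (k : K) : IsUnip ℬ ε (fun _ => w k) (diagBlock Y k) :=
  hY.submatrix (blockIdx_injective k)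

lemma IsUnip.principal {Y : Matrix (BIdx r) (BIdx r) R} (hY : IsUnip ℬ ε (fun i => w i.1) Y)
    (T : Finset K) : IsUnip ℬ ε (fun i => w i.1.1) (principal Y T) :=
  hY.submatrix Subtype.val_injective

variable [SetLike.GradedMonoid ℬ]

lemma IsUnip.quasidet (hε : IsNilpotentParameter ℬ N ε) {Y : Matrix (BIdx r) (BIdx r) R}
    (hY : IsUnip ℬ ε (fun i => w i.1) Y) {k : K} {T : Finset K} (hk : k ∉ T) :
    IsUnip ℬ ε (fun _ => w k) (quasidet Y k T) := by
  obtain ⟨⟨b, hb, hb'⟩, c, hc, hc'⟩ := hY.exists_blocks hk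
  rw [GradedLiouville.quasidet, hb', hc']
  exact (hY.diagBlock k).schur hε hb hc (hY.principal T)

lemma logTr_principal_cons (hε : IsNilpotentParameter ℬ N ε) (hθ : IsEulerDerivation ℬ ε θ)
    {Y : Matrix (BIdx r) (BIdx r) R} (hY : IsUnip ℬ ε (fun i => w i.1) Y) {k : K}
    {T T' : Finset K} (hk : k ∉ T) (hT : ∀ x, x ∈ T' ↔ x = k ∨ x ∈ T) :
    logTr θ (fun i => w i.1.1) (principal Y T') =
      logTr θ (fun _ => w k) (quasidet Y k T) + logTr θ (fun i => w i.1.1) (principal Y T) := by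
  obtain ⟨⟨b, hb, hb'⟩, c, hc, hc'⟩ := hY.exists_blocks hk
  rw [← logTr_submatrix (consEquiv r hk hT) ((hY.principal T').isUnit hε)]
  have h1 : (fun i : {i : BIdx r // i.1 ∈ T'} => w i.1.1) ∘ consEquiv r hk hT =
      Sum.elim (fun _ => w k) (fun i => w i.1.1) := by
    funext x
    rcases x with a | i <;> rfl
  have h2 : (principal Y T').submatrix (consEquiv r hk hT) (consEquiv r hk hT) =
      Matrix.fromBlocks (diagBlock Y k) (Y.submatrix (blockIdx r k) Subtype.val)
        (Y.submatrix Subtype.val (blockIdx r k)) (principal Y T) := by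
    ext x y
    rcases x with a | i <;> rcases y with b | j <;> rfl
  rw [h1, h2, quasidet, hb', hc',
    logTr_fromBlocks hε hθ (hY.diagBlock k) hb hc (hY.principal T)]

/-- For labels whose degrees have the same parity, the factors of the graded determinant of a
unipotent matrix exist, and its logarithmic derivative is the trace of that of the matrix. -/
lemma euler_gdet (hε : IsNilpotentParameter ℬ N ε) (hθ : IsEulerDerivation ℬ ε θ) {s : ZMod 2}
    (hs : ∀ k, sp (w k) (w k) = s) {Y : Matrix (BIdx r) (BIdx r) R}
    (hY : IsUnip ℬ ε (fun i => w i.1) Y) (l : List K) (hl : l.Nodup) :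
    IsUnipCentral ε (gdet l Y) ∧ GdetDefined l Y ∧
      θ (gdet l Y) =
        sgn s • logTr θ (fun i => w i.1.1) (principal Y l.toFinset) * gdet l Y := by
  induction l with
  | nil =>
    refine ⟨IsUnipCentral.one, trivial, ?_⟩
    have : IsEmpty {i : BIdx r // i.1 ∈ ([] : List K).toFinset} := ⟨fun i => by simpa using i.2⟩
    have h0 : logTr θ (fun i => w i.1.1) (principal Y ([] : List K).toFinset) = 0 :=
      Fintype.sum_empty _
    rw [h0, gdet, hθ.map_one, smul_zero, zero_mul]
  | cons k t ih =>
    obtain ⟨hk, ht⟩ := List.nodup_cons.1 hl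
    obtain ⟨ih1, ih2, ih3⟩ := ih ht
    have hk' : k ∉ t.toFinset := by simpa using hk
    have hq := hY.quasidet hε hk'
    have hb := hq.blockDet (γ := w k) (fun _ => rfl) hε
    refine ⟨hb.mul ih1, ⟨(hY.principal _).isUnit hε, ih2⟩, ?_⟩
    have hsq : ∀ a : R, sgn s • sgn s • a = a := by
      intro a
      have : ∀ s : ZMod 2, sgn s * sgn s = 1 := by decide
      rw [smul_smul, this, one_smul]
    have hcomm := Subring.mem_center_iff.1 hb.mem_center
    have hq' : logTr θ (fun _ => w k) (quasidet Y k t.toFinset) = sgn s •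
        ((quasidet Y k t.toFinset).map θ * Ring.inverse (quasidet Y k t.toFinset)).trace :=
      str_eq_smul_trace (fun _ => hs k) _
    rw [gdet, hθ.leibniz, ih3, euler_blockDet (γ := w k) (fun _ => rfl) hε hθ hq,
      logTr_principal_cons hε hθ hY hk' (T' := (k :: t).toFinset) (by simp), smul_add,
      hq', hsq, add_mul, mul_assoc, ← hcomm (_ * gdet t Y), mul_assoc (sgn s • _),
      hcomm (gdet t Y)]

/-- When all labels are listed, the principal submatrix is the whole matrix. -/
lemma logTr_principal_of_forall_mem (hε : IsNilpotentParameter ℬ N ε)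
    {Y : Matrix (BIdx r) (BIdx r) R} (hY : IsUnip ℬ ε (fun i => w i.1) Y) {T : Finset K}
    (hT : ∀ k, k ∈ T) :
    logTr θ (fun i => w i.1.1) (principal Y T) = logTr θ (fun i => w i.1) Y :=
  logTr_submatrix (w := fun i : BIdx r => w i.1) (M := Y)
    (Equiv.subtypeUnivEquiv fun i : BIdx r => hT i.1) (hY.isUnit hε)

end Gdet

/-! ### Uniqueness of the graded determinant on unipotent matrices -/

section GdetUnique

variable {n : ℕ} {R : Type*} [Ring R] [Algebra ℝ R] {ℬ : Deg n → Submodule ℝ R}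
variable {N : ℕ} {ε : Subring.center R}
variable {K : Type*} [Fintype K] [DecidableEq K] {w : K → Deg n} {r : K → ℕ}

lemma gdet_congr {X Y : Matrix (BIdx r) (BIdx r) R} (l : List K)
    (h : ∀ i j, i.1 ∈ l → j.1 ∈ l → X i j = Y i j) : gdet l X = gdet l Y := by
  induction l with
  | nil => rfl
  | cons k t ih =>
    have h1 : principal X t.toFinset = principal Y t.toFinset := by
      ext i j
      exact h _ _ (List.mem_cons_of_mem _ (List.mem_toFinset.1 i.2))
        (List.mem_cons_of_mem _ (List.mem_toFinset.1 j.2))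
    have h2 : diagBlock X k = diagBlock Y k := by
      ext i j
      exact h _ _ List.mem_cons_self List.mem_cons_self
    have h3 : X.submatrix (blockIdx r k) (Subtype.val : {i : BIdx r // i.1 ∈ t.toFinset} → _) =
        Y.submatrix (blockIdx r k) Subtype.val := by
      ext i j
      exact h _ _ List.mem_cons_self (List.mem_cons_of_mem _ (List.mem_toFinset.1 j.2))
    have h4 : X.submatrix (Subtype.val : {i : BIdx r // i.1 ∈ t.toFinset} → _) (blockIdx r k) =
        Y.submatrix Subtype.val (blockIdx r k) := by
      ext i j
      exact h _ _ (List.mem_cons_of_mem _ (List.mem_toFinset.1 i.2)) List.mem_cons_self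
    rw [gdet, gdet, quasidet, quasidet, h1, h2, h3, h4,
      ih fun i j hi hj => h i j (List.mem_cons_of_mem _ hi) (List.mem_cons_of_mem _ hj)]

lemma hasUnitDiagBlocks_of_apply {X : Matrix (BIdx r) (BIdx r) R}
    (h : ∀ i j, i.1 = j.1 → X i j = (1 : Matrix (BIdx r) (BIdx r) R) i j) :
    HasUnitDiagBlocks X := fun k => by
  rw [← Matrix.submatrix_one _ (blockIdx_injective (r := r) k)]
  ext a b
  exact h _ _ rfl

lemma idxOf_lt_idxOf_of_suffix {l t : List K} {k x : K} (hl : l.Nodup) (h : k :: t <:+ l)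
    (hx : x ∈ t) : l.idxOf k < l.idxOf x := by
  obtain ⟨p, rfl⟩ := h
  obtain ⟨-, hkt, hd⟩ := List.nodup_append'.1 hl
  have hk : k ∉ p := fun h => hd h List.mem_cons_self
  have hx' : x ∉ p := fun h => hd h (List.mem_cons_of_mem _ hx)
  have hne : k ≠ x := by
    rintro rfl
    exact (List.nodup_cons.1 hkt).1 hx
  rw [List.idxOf_append_of_notMem hk, List.idxOf_append_of_notMem hx', List.idxOf_cons_self,
    List.idxOf_cons_ne _ hne]
  omega

/-- The matrix with given blocks on the labels in `{k} ∪ T`, extended by the identity. -/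
def extendOne {k : K} {T : Finset K} (hk : k ∉ T)
    (M : Matrix (Fin (r k) ⊕ {i : BIdx r // i.1 ∈ T}) (Fin (r k) ⊕ {i : BIdx r // i.1 ∈ T}) R) :
    Matrix (BIdx r) (BIdx r) R :=
  (Matrix.fromBlocks M 0 0 1).submatrix (splitEquiv r hk).symm (splitEquiv r hk).symm

section

variable {k : K} {T : Finset K} (hk : k ∉ T)
  {M M' : Matrix (Fin (r k) ⊕ {i : BIdx r // i.1 ∈ T}) (Fin (r k) ⊕ {i : BIdx r // i.1 ∈ T}) R}

lemma extendOne_apply (x y) :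
    extendOne hk M (splitEquiv r hk x) (splitEquiv r hk y) = Matrix.fromBlocks M 0 0 1 x y := by
  simp [extendOne]

/-- Blocks of `M` that agree with those of the identity matrix remain so in the extension. -/
lemma extendOne_apply_eq_one {p : K → K → Prop}
    (hM : ∀ x y, ¬ p (splitEquiv r hk (Sum.inl x)).1 (splitEquiv r hk (Sum.inl y)).1 →
      M x y = (1 : Matrix _ _ R) x y) (i j : BIdx r) (h : ¬ p i.1 j.1) :
    extendOne hk M i j = (1 : Matrix (BIdx r) (BIdx r) R) i j := by
  obtain ⟨x, rfl⟩ := (splitEquiv r hk).surjective i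
  obtain ⟨y, rfl⟩ := (splitEquiv r hk).surjective j
  have hone : (1 : Matrix (BIdx r) (BIdx r) R) (splitEquiv r hk x) (splitEquiv r hk y) =
      (1 : Matrix _ _ R) x y := by simp [Matrix.one_apply]
  rw [extendOne_apply, hone, ← Matrix.fromBlocks_one]
  rcases x with x | x <;> rcases y with y | y
  · exact hM x y h
  all_goals rfl

lemma extendOne_mul : extendOne hk (M * M') = extendOne hk M * extendOne hk M' := by
  rw [extendOne, extendOne, extendOne, Matrix.submatrix_mul_equiv, Matrix.fromBlocks_multiply]
  simp

lemma IsUnip.extendOne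
    (hM : IsUnip ℬ ε (Sum.elim (fun _ : Fin (r k) => w k)
      (fun i : {i : BIdx r // i.1 ∈ T} => w i.1.1)) M) :
    IsUnip ℬ ε (fun i => w i.1) (extendOne hk M) := by
  have h1 := hM.fromBlocks (v := fun i : {i : BIdx r // ¬ i.1 ∈ insert k T} => w i.1.1)
    IsHom.zero IsHom.zero IsUnip.one
  have h2 := h1.submatrix (splitEquiv r hk).symm.injective
  rw [smul_zero, smul_zero] at h2
  suffices hw : (fun i : BIdx r => w i.1) = Sum.elim (Sum.elim (fun _ : Fin (r k) => w k)
      fun i : {i : BIdx r // i.1 ∈ T} => w i.1.1)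
      (fun i : {i : BIdx r // ¬ i.1 ∈ insert k T} => w i.1.1) ∘ (splitEquiv r hk).symm by
    rw [hw]
    exact h2
  funext i
  obtain ⟨x, rfl⟩ := (splitEquiv r hk).surjective i
  rw [Function.comp_apply, Equiv.symm_apply_apply]
  rcases x with (a | i) | i <;> rfl

end

variable [SetLike.GradedMonoid ℬ]

/-- A map with the properties of the graded determinant agrees with the product of the determinants
of the quasideterminants, on unipotent matrices that are the identity outside of the labels in a
final segment `t` of the list of labels. -/
lemma IsGradedDeterminant.eq_gdet_of_suffix (hε : IsNilpotentParameter ℬ N ε) {l : List K}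
    (hl : l.Nodup) {D : Matrix (BIdx r) (BIdx r) R → R} (hD : IsGradedDeterminant ℬ w l D)
    (t : List K) (ht : t <:+ l) {Y : Matrix (BIdx r) (BIdx r) R}
    (hY : IsUnip ℬ ε (fun i => w i.1) Y)
    (h1 : ∀ i j, ¬ (i.1 ∈ t ∧ j.1 ∈ t) → Y i j = (1 : Matrix (BIdx r) (BIdx r) R) i j) :
    D Y = gdet t Y := by
  have hom {Z : Matrix (BIdx r) (BIdx r) R} (hZ : IsUnip ℬ ε (fun i => w i.1) Z) :
      IsHomogeneousMatrix ℬ w 0 Z := (isHomogeneousMatrix_iff ℬ w Z).2 (hZ.isHom hε)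
  induction t generalizing Y with
  | nil =>
    have : Y = 1 := by
      ext i j
      exact h1 i j (by simp)
    subst this
    exact hD.upper _ (hom hY) (fun k => Matrix.submatrix_one _ (blockIdx_injective k))
      Matrix.blockTriangular_one
  | cons k t ih =>
    have hkt := hl.sublist ht.sublist
    have hk : k ∉ t.toFinset := by simpa using (List.nodup_cons.1 hkt).1
    have hlt : ∀ x ∈ t.toFinset, l.idxOf k < l.idxOf x := fun x hx =>
      idxOf_lt_idxOf_of_suffix hl ht (List.mem_toFinset.1 hx)
    obtain ⟨⟨b, hb, hb'⟩, c, hc, hc'⟩ := hY.exists_blocks hk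
    have hd := hY.principal t.toFinset
    have hdi := (hd.inverse hε).isHom hε
    have hS := hY.quasidet hε hk
    set d := principal Y t.toFinset with hd_def
    set S := quasidet Y k t.toFinset with hS_def
    set U := extendOne hk (Matrix.fromBlocks 1 (ε • (b * Ring.inverse d)) 0 1) with hU_def
    set L := extendOne hk (Matrix.fromBlocks 1 0 (ε • (Ring.inverse d * c)) 1) with hL_def
    set P := extendOne hk (Matrix.fromBlocks S 0 0 1) with hP_def
    set Q := extendOne hk (Matrix.fromBlocks 1 0 0 d) with hQ_def
    -- `Y` is the product of two unitriangular matrices, a block-diagonal matrix with the single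
    -- nontrivial block `S`, and a matrix that is the identity outside of the labels in `t`.
    have hfac : Y = U * (P * Q) * L := by
      rw [hU_def, hP_def, hQ_def, hL_def, ← extendOne_mul, ← extendOne_mul, ← extendOne_mul,
        ← Matrix.smul_mul, ← Matrix.mul_smul, ← hb', ← hc',
        Matrix.fromBlocks_multiply (A := S)]
      simp only [Matrix.mul_zero, Matrix.zero_mul, add_zero, zero_add, mul_one, one_mul]
      rw [hS_def, quasidet, ← fromBlocks_eq_mul_mul _ _ _ (hd.isUnit hε)]
      ext i j
      obtain ⟨x, rfl⟩ := (splitEquiv r hk).surjective i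
      obtain ⟨y, rfl⟩ := (splitEquiv r hk).surjective j
      rw [extendOne_apply]
      have hout : ∀ z : {i : BIdx r // ¬ i.1 ∈ insert k t.toFinset},
          (splitEquiv r hk (Sum.inr z)).1 ∉ k :: t := fun z hz => by
        have hz' : z.1.1 ∈ k :: t := hz
        exact z.2 (by simpa using hz')
      have hone : ∀ x y, (1 : Matrix (BIdx r) (BIdx r) R) (splitEquiv r hk x) (splitEquiv r hk y) =
          (1 : Matrix _ _ R) x y := fun x y => by simp [Matrix.one_apply]
      rcases x with (x | x) | x <;> rcases y with (y | y) | y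
      any_goals rfl
      all_goals
        rw [h1 _ _ fun h => (by first | exact hout _ h.1 | exact hout _ h.2), hone,
          ← Matrix.fromBlocks_one]
        simp
    have hUu : IsUnip ℬ ε (fun i => w i.1) U := IsUnip.extendOne hk <| by
      have := (IsUnip.one (ℬ := ℬ) (ε := ε) (w := fun _ : Fin (r k) => w k)).fromBlocks
        (hb.mul hdi) IsHom.zero (IsUnip.one (ε := ε))
      rwa [smul_zero] at this
    have hLu : IsUnip ℬ ε (fun i => w i.1) L := IsUnip.extendOne hk <| by
      have := (IsUnip.one (ℬ := ℬ) (ε := ε) (w := fun _ : Fin (r k) => w k)).fromBlocks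
        IsHom.zero (hdi.mul hc) (IsUnip.one (ε := ε))
      rwa [smul_zero] at this
    have hPu : IsUnip ℬ ε (fun i => w i.1) P := IsUnip.extendOne hk <| by
      have := hS.fromBlocks IsHom.zero IsHom.zero
        (IsUnip.one (ε := ε) (w := fun i : {i : BIdx r // i.1 ∈ t.toFinset} => w i.1.1))
      rwa [smul_zero, smul_zero] at this
    have hQu : IsUnip ℬ ε (fun i => w i.1) Q := IsUnip.extendOne hk <| by
      have := (IsUnip.one (ℬ := ℬ) (ε := ε) (w := fun _ : Fin (r k) => w k)).fromBlocks
        IsHom.zero IsHom.zero hd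
      rwa [smul_zero, smul_zero] at this
    have ne_of_idx {i j : BIdx r} (hij : l.idxOf j.1 < l.idxOf i.1) : i ≠ j := by
      rintro rfl
      exact lt_irrefl _ hij
    have hU1 := extendOne_apply_eq_one hk (p := fun x y => x = k ∧ y ∈ t.toFinset)
      (M := Matrix.fromBlocks 1 (ε • (b * Ring.inverse d)) 0 1) (by
        rw [← Matrix.fromBlocks_one]
        rintro (x | x) (y | y) h
        exacts [rfl, absurd ⟨rfl, y.2⟩ h, rfl, rfl])
    have hL1 := extendOne_apply_eq_one hk (p := fun x y => x ∈ t.toFinset ∧ y = k)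
      (M := Matrix.fromBlocks 1 0 (ε • (Ring.inverse d * c)) 1) (by
        rw [← Matrix.fromBlocks_one]
        rintro (x | x) (y | y) h
        exacts [rfl, rfl, absurd ⟨x.2, rfl⟩ h, rfl])
    have hP1 := extendOne_apply_eq_one hk (p := fun x y => x = k ∧ y = k)
      (M := Matrix.fromBlocks S 0 0 1) (by
        rw [← Matrix.fromBlocks_one]
        rintro (x | x) (y | y) h
        exacts [absurd ⟨rfl, rfl⟩ h, rfl, rfl, rfl])
    have hQ1 := extendOne_apply_eq_one hk (p := fun x y => x ∈ t.toFinset ∧ y ∈ t.toFinset)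
      (M := Matrix.fromBlocks 1 0 0 d) (by
        rw [← Matrix.fromBlocks_one]
        rintro (x | x) (y | y) h
        exacts [rfl, rfl, rfl, absurd ⟨x.2, y.2⟩ h])
    have hDU : D U = 1 := by
      refine hD.upper _ (hom hUu) (hasUnitDiagBlocks_of_apply fun i j hij => hU1 i j ?_)
        fun i j hij => ?_
      · rintro ⟨hi, hj⟩
        exact hk (hi ▸ hij ▸ hj)
      · refine (hU1 i j ?_).trans (Matrix.one_apply_ne (ne_of_idx hij))
        rintro ⟨hi, hj⟩
        refine lt_asymm hij ?_
        change l.idxOf i.1 < l.idxOf j.1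
        rw [hi]
        exact hlt _ hj
    have hDL : D L = 1 := by
      refine hD.lower _ (hom hLu) (hasUnitDiagBlocks_of_apply fun i j hij => hL1 i j ?_)
        fun i j hij => ?_
      · rintro ⟨hi, hj⟩
        exact hk (hj ▸ hij ▸ hi)
      · refine (hL1 j i ?_).trans (Matrix.one_apply_ne (ne_of_idx hij).symm)
        rintro ⟨hj, hi⟩
        refine lt_asymm hij ?_
        change l.idxOf i.1 < l.idxOf j.1
        rw [hi]
        exact hlt _ hj
    have hDP : D P = blockDet S := by
      rw [hD.diag _ (hom hPu)]
      · rw [List.prod_map_eq_pow_single k, List.count_eq_one_of_mem hl (ht.subset List.mem_cons_self),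
          pow_one]
        · congr 1
          ext a b
          exact extendOne_apply hk (Sum.inl (Sum.inl a)) (Sum.inl (Sum.inl b))
        · intro x hx _
          have hx1 : diagBlock P x = (1 : Matrix _ _ (Subring.center R)).map
              (Subring.center R).subtype := by
            rw [Matrix.map_one _ (map_zero _) (map_one _),
              ← Matrix.submatrix_one _ (blockIdx_injective (r := r) x)]
            ext a b
            exact hP1 _ _ fun h => hx h.1
          rw [hx1, blockDet_map_subtype, Matrix.det_one, Subring.coe_one]
      · intro i j hij
        exact (hP1 i j fun h => hij (h.1.trans h.2.symm)).trans
          (Matrix.one_apply_ne fun h => hij (congrArg _ h))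
    have hDQ : D Q = gdet t Y := by
      rw [ih ((List.suffix_cons _ _).trans ht) hQu]
      · refine gdet_congr t fun i j hi hj => ?_
        exact extendOne_apply hk (Sum.inl (Sum.inr ⟨i, List.mem_toFinset.2 hi⟩))
          (Sum.inl (Sum.inr ⟨j, List.mem_toFinset.2 hj⟩))
      · exact fun i j h => hQ1 i j fun h' =>
          h ⟨List.mem_toFinset.1 h'.1, List.mem_toFinset.1 h'.2⟩
    have hPQ := hPu.mul hε hQu
    rw [gdet, ← hS_def, ← hDP, ← hDQ, hfac, hD.mul _ _ (hom (hUu.mul hε hPQ)) (hom hLu),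
      hD.mul _ _ (hom hUu) (hom hPQ), hD.mul _ _ (hom hPu) (hom hQu), hDU, hDL, one_mul, mul_one]

lemma IsGradedDeterminant.eq_gdet (hε : IsNilpotentParameter ℬ N ε) {l : List K}
    (hl : l.Nodup) (hl' : ∀ k, k ∈ l) {D : Matrix (BIdx r) (BIdx r) R → R}
    (hD : IsGradedDeterminant ℬ w l D) {Y : Matrix (BIdx r) (BIdx r) R}
    (hY : IsUnip ℬ ε (fun i => w i.1) Y) : D Y = gdet l Y :=
  hD.eq_gdet_of_suffix hε hl l List.suffix_rfl hY fun _ _ h => absurd ⟨hl' _, hl' _⟩ h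

end GdetUnique

/-! ### The graded Berezinian of a unipotent matrix -/

section Gber

variable {n : ℕ} {R : Type*} [Ring R] [Algebra ℝ R] {ℬ : Deg n → Submodule ℝ R}
variable {N : ℕ} {ε : Subring.center R} {θ : R →ₗ[ℝ] R} {r : Deg n → ℕ}

lemma evenIdx_injective : Function.Injective (evenIdx r) := by
  rintro ⟨⟨γ, hγ⟩, a⟩ ⟨⟨δ, hδ⟩, b⟩ h
  simp only [evenIdx, Sigma.mk.injEq] at h
  obtain ⟨rfl, h⟩ := h
  rw [eq_of_heq h]

lemma oddIdx_injective : Function.Injective (oddIdx r) := by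
  rintro ⟨⟨γ, hγ⟩, a⟩ ⟨⟨δ, hδ⟩, b⟩ h
  simp only [oddIdx, Sigma.mk.injEq] at h
  obtain ⟨rfl, h⟩ := h
  rw [eq_of_heq h]

lemma evenIdx_ne_oddIdx (i : BIdx fun γ : EvenDeg n => r γ) (j : BIdx fun γ : OddDeg n => r γ) :
    evenIdx r i ≠ oddIdx r j := fun h => by
  have h1 : i.1.1 = j.1.1 := congrArg Sigma.fst h
  have h2 := i.1.2
  rw [h1, j.1.2] at h2
  exact one_ne_zero h2

/-- The splitting of the indices into even and odd ones. -/
def parityEquiv (r : Deg n → ℕ) :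
    (BIdx fun γ : EvenDeg n => r γ) ⊕ (BIdx fun γ : OddDeg n => r γ) ≃ BIdx r :=
  Equiv.ofBijective (Sum.elim (evenIdx r) (oddIdx r))
    ⟨evenIdx_injective.sumElim oddIdx_injective evenIdx_ne_oddIdx, by
      rintro ⟨γ, a⟩
      have h : ∀ s : ZMod 2, s = 0 ∨ s = 1 := by decide
      rcases h (sp γ γ) with h | h
      · exact ⟨Sum.inl ⟨⟨γ, h⟩, a⟩, rfl⟩
      · exact ⟨Sum.inr ⟨⟨γ, h⟩, a⟩, rfl⟩⟩

lemma submatrix_parityEquiv (X : Matrix (BIdx r) (BIdx r) R) :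
    X.submatrix (parityEquiv r) (parityEquiv r) =
      Matrix.fromBlocks (block11 X) (block12 X) (block21 X) (block22 X) := by
  ext (i | i) (j | j) <;> rfl

lemma deg_comp_parityEquiv : (fun i : BIdx r => i.1) ∘ parityEquiv r =
    Sum.elim (fun i => i.1.1) (fun i => i.1.1) := by
  funext i
  rcases i with i | i <;> rfl

variable {E : Matrix (BIdx r) (BIdx r) R}

lemma IsUnip.block11 (hE : IsUnip ℬ ε (fun i => i.1) E) :
    IsUnip ℬ ε (fun i => i.1.1) (block11 E) := hE.submatrix evenIdx_injective

lemma IsUnip.block22 (hE : IsUnip ℬ ε (fun i => i.1) E) :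
    IsUnip ℬ ε (fun i => i.1.1) (block22 E) := hE.submatrix oddIdx_injective

lemma IsUnip.exists_block12 (hE : IsUnip ℬ ε (fun i => i.1) E) :
    ∃ b, IsHom ℬ (fun i => i.1.1) (fun i => i.1.1) b ∧ block12 E = ε • b :=
  hE.exists_offDiag (evenIdx r) (oddIdx r) evenIdx_ne_oddIdx

lemma IsUnip.exists_block21 (hE : IsUnip ℬ ε (fun i => i.1) E) :
    ∃ c, IsHom ℬ (fun i => i.1.1) (fun i => i.1.1) c ∧ block21 E = ε • c :=
  hE.exists_offDiag (oddIdx r) (evenIdx r) fun i j => (evenIdx_ne_oddIdx j i).symm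

variable [SetLike.GradedMonoid ℬ]

lemma IsUnip.quasidet11 (hε : IsNilpotentParameter ℬ N ε)
    (hE : IsUnip ℬ ε (fun i => i.1) E) :
    IsUnip ℬ ε (fun i => i.1.1) (quasidet11 E) := by
  obtain ⟨b, hb, hb'⟩ := hE.exists_block12
  obtain ⟨c, hc, hc'⟩ := hE.exists_block21
  rw [GradedLiouville.quasidet11, hb', hc']
  exact hE.block11.schur hε hb hc hE.block22

lemma logTr_eq_add (hε : IsNilpotentParameter ℬ N ε) (hθ : IsEulerDerivation ℬ ε θ)
    (hE : IsUnip ℬ ε (fun i => i.1) E) :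
    logTr θ (fun i => i.1) E =
      logTr θ (fun i => i.1.1) (quasidet11 E) + logTr θ (fun i => i.1.1) (block22 E) := by
  obtain ⟨b, hb, hb'⟩ := hE.exists_block12
  obtain ⟨c, hc, hc'⟩ := hE.exists_block21
  rw [← logTr_submatrix (parityEquiv r) (hE.isUnit hε), deg_comp_parityEquiv,
    submatrix_parityEquiv, quasidet11, hb', hc', logTr_fromBlocks hε hθ hE.block11 hb hc hE.block22]

lemma euler_ringInverse (hθ : IsEulerDerivation ℬ ε θ) {z c : R} (hz : IsUnit z)
    (h : θ z = c * z) : θ (Ring.inverse z) = -(Ring.inverse z * c) := by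
  have h1 := hθ.leibniz z (Ring.inverse z)
  rw [Ring.mul_inverse_cancel z hz, hθ.map_one, h, mul_assoc, Ring.mul_inverse_cancel z hz,
    mul_one] at h1
  have h2 : θ (Ring.inverse z) = Ring.inverse z * (z * θ (Ring.inverse z)) := by
    rw [Ring.inverse_mul_cancel_left _ _ hz]
  rw [h2, eq_neg_of_add_eq_zero_right h1.symm, mul_neg]

/-- The graded Berezinian of a unipotent matrix exists, and its logarithmic derivative is the
supertrace of that of the matrix: the inverse of the determinant of the odd part supplies the sign
of the odd part of the supertrace. -/
lemma euler_gber (hε : IsNilpotentParameter ℬ N ε) (hθ : IsEulerDerivation ℬ ε θ)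
    {l₀ : List (EvenDeg n)} (hl₀ : l₀.Nodup) (hl₀' : ∀ γ, γ ∈ l₀)
    {l₁ : List (OddDeg n)} (hl₁ : l₁.Nodup) (hl₁' : ∀ γ, γ ∈ l₁)
    (hE : IsUnip ℬ ε (fun i => i.1) E) :
    IsUnipCentral ε (gber l₀ l₁ E) ∧ GberDefined l₀ l₁ E ∧
      θ (gber l₀ l₁ E) = logTr θ (fun i => i.1) E * gber l₀ l₁ E := by
  have hS := hE.quasidet11 hε
  have hd := hE.block22
  obtain ⟨a1, a2, a3⟩ := euler_gdet (w := Subtype.val) hε hθ (s := 0) (fun γ : EvenDeg n => γ.2)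
    hS l₀ hl₀
  obtain ⟨b1, b2, b3⟩ := euler_gdet (w := Subtype.val) hε hθ (s := 1) (fun γ : OddDeg n => γ.2)
    hd l₁ hl₁
  have hu := b1.isUnit hε.pow_eq_zero
  have hi := b1.inverse hε.pow_eq_zero
  have s0 : sgn 0 = 1 := by decide
  have s1 : sgn 1 = -1 := by decide
  rw [logTr_principal_of_forall_mem (w := Subtype.val) hε hS (by simpa using hl₀'), s0,
    one_smul] at a3
  rw [logTr_principal_of_forall_mem (w := Subtype.val) hε hd (by simpa using hl₁'), s1,
    neg_smul, one_smul] at b3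
  refine ⟨a1.mul hi, ⟨hd.isUnit hε, a2, b2, hu⟩, ?_⟩
  rw [gber, hθ.leibniz, a3, euler_ringInverse hθ hu b3, logTr_eq_add hε hθ hE, add_mul, mul_assoc,
    mul_neg, mul_neg, mul_neg, neg_neg, ← mul_assoc (gdet l₀ _),
    ← Subring.mem_center_iff.1 (a1.mul hi).mem_center]

/-! ### Uniqueness of the graded Berezinian on unipotent matrices -/

section

variable {a : Matrix (BIdx fun γ : EvenDeg n => r γ) (BIdx fun γ : EvenDeg n => r γ) R}
  {b : Matrix (BIdx fun γ : EvenDeg n => r γ) (BIdx fun γ : OddDeg n => r γ) R}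
  {c : Matrix (BIdx fun γ : OddDeg n => r γ) (BIdx fun γ : EvenDeg n => r γ) R}
  {d : Matrix (BIdx fun γ : OddDeg n => r γ) (BIdx fun γ : OddDeg n => r γ) R}

/-- The matrix with given even-odd blocks. -/
def ofParityBlocks
    (a : Matrix (BIdx fun γ : EvenDeg n => r γ) (BIdx fun γ : EvenDeg n => r γ) R)
    (b : Matrix (BIdx fun γ : EvenDeg n => r γ) (BIdx fun γ : OddDeg n => r γ) R)
    (c : Matrix (BIdx fun γ : OddDeg n => r γ) (BIdx fun γ : EvenDeg n => r γ) R)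
    (d : Matrix (BIdx fun γ : OddDeg n => r γ) (BIdx fun γ : OddDeg n => r γ) R) :
    Matrix (BIdx r) (BIdx r) R :=
  (Matrix.fromBlocks a b c d).submatrix (parityEquiv r).symm (parityEquiv r).symm

lemma blocks_ofParityBlocks :
    block11 (ofParityBlocks a b c d) = a ∧ block12 (ofParityBlocks a b c d) = b ∧
      block21 (ofParityBlocks a b c d) = c ∧ block22 (ofParityBlocks a b c d) = d := by
  have h : (ofParityBlocks a b c d).submatrix (parityEquiv r) (parityEquiv r) =
      Matrix.fromBlocks a b c d := by simp [ofParityBlocks]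
  rw [submatrix_parityEquiv] at h
  exact Matrix.fromBlocks_inj.1 h

lemma isGL0_ofParityBlocks (hε : IsNilpotentParameter ℬ N ε)
    (ha : IsUnip ℬ ε (fun i => i.1.1) a) (hb : IsHom ℬ (fun i => i.1.1) (fun i => i.1.1) b)
    (hc : IsHom ℬ (fun i => i.1.1) (fun i => i.1.1) c) (hd : IsUnip ℬ ε (fun i => i.1.1) d) :
    IsGL0 ℬ (ofParityBlocks a (ε • b) (ε • c) d) := by
  have h := (ha.fromBlocks hb hc hd).submatrix (parityEquiv r).symm.injective
  rw [← deg_comp_parityEquiv, Function.comp_assoc, Equiv.self_comp_symm, Function.comp_id] at h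
  exact ⟨(isHomogeneousMatrix_iff ℬ id _).2 (h.isHom hε), h.isUnit hε⟩

end

/-- Every map with the properties of the graded Berezinian agrees with `gber` on unipotent
matrices, by the `UDL` decomposition. -/
lemma IsGradedBerezinian.eq_gber (hε : IsNilpotentParameter ℬ N ε)
    {l₀ : List (EvenDeg n)} (hl₀ : l₀.Nodup) (hl₀' : ∀ γ, γ ∈ l₀)
    {l₁ : List (OddDeg n)} (hl₁ : l₁.Nodup) (hl₁' : ∀ γ, γ ∈ l₁)
    {D₀ : Matrix (BIdx fun γ : EvenDeg n => r γ) (BIdx fun γ : EvenDeg n => r γ) R → R}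
    {D₁ : Matrix (BIdx fun γ : OddDeg n => r γ) (BIdx fun γ : OddDeg n => r γ) R → R}
    {Ber : Matrix (BIdx r) (BIdx r) R → R}
    (hD₀ : IsGradedDeterminant ℬ Subtype.val l₀ D₀)
    (hD₁ : IsGradedDeterminant ℬ Subtype.val l₁ D₁) (hBer : IsGradedBerezinian ℬ D₀ D₁ Ber)
    (hE : IsUnip ℬ ε (fun i => i.1) E) : Ber E = gber l₀ l₁ E := by
  have hS := hE.quasidet11 hε
  have hd := hE.block22
  have hdi := (hd.inverse hε).isHom hε
  obtain ⟨b, hb, hb'⟩ := hE.exists_block12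
  obtain ⟨c, hc, hc'⟩ := hE.exists_block21
  have one0 := IsUnip.one (ℬ := ℬ) (ε := ε) (w := fun i : BIdx fun γ : EvenDeg n => r γ => i.1.1)
  have one1 := IsUnip.one (ℬ := ℬ) (ε := ε) (w := fun i : BIdx fun γ : OddDeg n => r γ => i.1.1)
  have hU := isGL0_ofParityBlocks hε one0 (hb.mul hdi) IsHom.zero one1
  have hP := isGL0_ofParityBlocks hε hS IsHom.zero IsHom.zero hd
  have hL := isGL0_ofParityBlocks hε one0 IsHom.zero (hdi.mul hc) one1
  have hUP : IsGL0 ℬ _ := ⟨(isHomogeneousMatrix_iff ℬ id _).2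
    (((isHomogeneousMatrix_iff ℬ id _).1 hU.1).mul ((isHomogeneousMatrix_iff ℬ id _).1 hP.1)),
    hU.2.mul hP.2⟩
  obtain ⟨u1, u2, u3, u4⟩ := blocks_ofParityBlocks (r := r) (R := R)
    (a := 1) (b := ε • (b * Ring.inverse (block22 E))) (c := ε • 0) (d := 1)
  obtain ⟨p1, p2, p3, p4⟩ := blocks_ofParityBlocks (r := r) (R := R)
    (a := quasidet11 E) (b := ε • 0) (c := ε • 0) (d := block22 E)
  obtain ⟨v1, v2, v3, v4⟩ := blocks_ofParityBlocks (r := r) (R := R)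
    (a := 1) (b := ε • 0) (c := ε • (Ring.inverse (block22 E) * c)) (d := 1)
  have hfac : E = ofParityBlocks 1 (ε • (b * Ring.inverse (block22 E))) (ε • 0) 1 *
      ofParityBlocks (quasidet11 E) (ε • 0) (ε • 0) (block22 E) *
      ofParityBlocks 1 (ε • 0) (ε • (Ring.inverse (block22 E) * c)) 1 := by
    rw [ofParityBlocks, ofParityBlocks, ofParityBlocks, Matrix.submatrix_mul_equiv,
      Matrix.submatrix_mul_equiv, smul_zero, smul_zero, ← Matrix.smul_mul, ← Matrix.mul_smul,
      ← hb', ← hc', quasidet11, ← fromBlocks_eq_mul_mul _ _ _ (hd.isUnit hε),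
      ← submatrix_parityEquiv]
    simp
  have key : Ber E = D₀ (quasidet11 E) * Ring.inverse (D₁ (block22 E)) := by
    conv_lhs => rw [hfac]
    rw [hBer.mul _ _ hUP hL, hBer.mul _ _ hU hP,
      hBer.upper _ hU u1 u4 (u3.trans (smul_zero _)),
      hBer.lower _ hL v1 v4 (v2.trans (smul_zero _)),
      hBer.diag _ hP (p2.trans (smul_zero _)) (p3.trans (smul_zero _)), p1, p4, one_mul, mul_one]
  rw [key, hD₀.eq_gdet hε hl₀ hl₀' hS, hD₁.eq_gdet hε hl₁ hl₁' hd, gber]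

end Gber

/-! ### The differential equation of the exponential -/

section Exponential

variable {n : ℕ} {R : Type*} [Ring R] [Algebra ℝ R] {ℬ : Deg n → Submodule ℝ R}
variable {N : ℕ} {ε : Subring.center R} {θ : R →ₗ[ℝ] R}

/-- If `Θ` is a derivation with `Θ(Z) = Z`, then `Θ(exp Z) = Z exp Z`. -/
lemma map_nilExp {S : Type*} [Ring S] [Algebra ℝ S] (Θ : S →ₗ[ℝ] S)
    (hΘ : ∀ a b, Θ (a * b) = Θ a * b + a * Θ b) {Z : S} (hZ : Θ Z = Z) (hN : Z ^ N = 0) :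
    Θ (nilExp N Z) = Z * nilExp N Z := by
  -- `Z` commutes with `Θ(Z)`, so that no order of factors has to be respected here.
  have hpow : ∀ k : ℕ, Θ (Z ^ k) = (k : ℝ) • Z ^ k := by
    intro k
    induction k with
    | zero => simpa using hΘ 1 1
    | succ k ih =>
      rw [pow_succ, hΘ, ih, hZ, smul_mul_assoc, Nat.cast_succ, add_smul, one_smul]
  rw [nilExp, map_sum]
  simp only [map_smul, hpow]
  cases N with
  | zero => simp
  | succ M =>
    rw [Finset.sum_range_succ', Finset.sum_range_succ, mul_add, mul_smul_comm, ← pow_succ', hN,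
      Finset.mul_sum]
    simp only [Nat.cast_zero, zero_smul, smul_zero, add_zero]
    refine Finset.sum_congr rfl fun k _ => ?_
    rw [mul_smul_comm, ← pow_succ', smul_smul]
    congr 1
    rw [Nat.factorial_succ, Nat.cast_mul]
    have : (k ! : ℝ) ≠ 0 := by positivity
    have : ((k + 1 : ℕ) : ℝ) ≠ 0 := by positivity
    field_simp

/-- The exponential of `ε P` is `1 + ε(⋯)`. For `N = 0` the sum is empty, but then `1 = 0`. -/
lemma nilExp_eq_one_add {S : Type*} [Ring S] [Algebra ℝ S] [Module (Subring.center R) S]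
    [SMulCommClass (Subring.center R) S S] [IsScalarTower (Subring.center R) S S]
    [SMulCommClass ℝ (Subring.center R) S] (hε : ε ^ N = 0) (P : S) :
    nilExp N (ε • P) = 1 + ε • ∑ k ∈ Finset.range (N - 1),
      (((k + 1)! : ℝ)⁻¹) • (P * (ε • P) ^ k) := by
  cases N with
  | zero =>
    have h (a : S) : a = 0 := by
      rw [← one_smul (Subring.center R) a, ← pow_zero ε, hε, zero_smul]
    rw [h (nilExp _ _), h (1 + _)]
  | succ M =>
    rw [nilExp, Finset.sum_range_succ', add_comm, Finset.smul_sum]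
    congr 1
    · simp
    · refine Finset.sum_congr rfl fun k _ => ?_
      rw [pow_succ', smul_mul_assoc, smul_comm]

/-- Solutions of `θ(f) = c f`, with `c` divisible by `ε`, are determined by their constant term. -/
lemma eq_of_euler_eq (hθ : IsEulerDerivation ℬ ε θ) (hε : ε ^ N = 0) {f g c u : R}
    (hf : θ f = (ε • c) * f) (hg : θ g = (ε • c) * g) (h : f - g = ε • u) : f = g := by
  have hθε (v : R) : θ (ε • v) = ε • v + ε • θ v := by
    change θ (ε * v) = ε * v + ε * θ v
    rw [hθ.leibniz, hθ.eps]
  have hpow (k : ℕ) (v : R) : θ (ε ^ k • v) = (k : ℝ) • ε ^ k • v + ε ^ k • θ v := by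
    induction k generalizing v with
    | zero => simp
    | succ k ih =>
      rw [pow_succ, mul_smul, ih, hθε, smul_add, ← add_assoc, Nat.cast_succ, add_smul, one_smul,
        mul_smul]
  have hfg : θ (f - g) = (ε • c) * (f - g) := by rw [map_sub, hf, hg, mul_sub]
  -- The coefficient of `ε ^ (k + 1)` in `f - g` is determined by the lower ones.
  have key (k : ℕ) : ∃ v, f - g = ε ^ (k + 1) • v := by
    induction k with
    | zero => exact ⟨u, by simpa using h⟩
    | succ k ih =>
      obtain ⟨v, hv⟩ := ih
      obtain ⟨v', hv'⟩ := hθ.dvd v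
      rw [hv, hpow, hv', smul_mul_assoc, mul_smul_comm] at hfg
      have hk : ((k + 1 : ℕ) : ℝ) ≠ 0 := by positivity
      refine ⟨((k + 1 : ℕ) : ℝ)⁻¹ • (c * v - v'), ?_⟩
      rw [hv, eq_inv_smul_iff₀ hk |>.2 (eq_sub_of_add_eq hfg), smul_comm (ε ^ (k + 1 + 1)),
        pow_succ _ (k + 1), mul_smul, smul_comm ε (ε ^ (k + 1)) (c * v)]
      simp only [smul_sub]
  obtain ⟨v, hv⟩ := key N
  rw [pow_succ', hε, mul_zero, zero_smul] at hv
  exact sub_eq_zero.1 hv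

lemma gtr_zero_eq_str {r : Deg n → ℕ} (X : Matrix (BIdx r) (BIdx r) R) :
    gtr 0 X = str (fun i => i.1) X := by
  rw [gtr, str, Fintype.sum_sigma]
  simp only [add_zero, Matrix.trace, Finset.smul_sum]
  rfl

variable [SetLike.GradedMonoid ℬ]

lemma IsUnip.nilExp {ι : Type*} [Fintype ι] [DecidableEq ι] {w : ι → Deg n}
    (hε : IsNilpotentParameter ℬ N ε) {P : Matrix ι ι R} (hP : IsHom ℬ w w P) :
    IsUnip ℬ ε w (nilExp N (ε • P)) :=
  ⟨_, IsHom.sum fun k _ i j => (ℬ _).smul_mem _ ((hP.mul ((hP.center_smul hε.mem).pow k)) i j),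
    nilExp_eq_one_add hε.pow_eq_zero P⟩

/-- The logarithmic derivative of `exp Z` is `Z`. -/
lemma logTr_nilExp {ι : Type*} [Fintype ι] [DecidableEq ι] {w : ι → Deg n}
    (hε : IsNilpotentParameter ℬ N ε) (hθ : IsEulerDerivation ℬ ε θ) {P : Matrix ι ι R}
    (hP : IsHom ℬ w w P) (hZ : (ε • P).map θ = ε • P) :
    logTr θ w (nilExp N (ε • P)) = str w (ε • P) := by
  have h := map_nilExp (N := N) (θ.mapMatrix : Matrix ι ι R →ₗ[ℝ] Matrix ι ι R)
    hθ.map_matrix_mul (Z := ε • P) hZ (by rw [smul_pow, hε.pow_eq_zero, zero_smul])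
  rw [logTr]
  change str w (θ.mapMatrix _ * _) = _
  rw [h, mul_assoc, (IsUnip.nilExp hε hP).mul_inverse hε, mul_one]

/-- Liouville's formula: both sides solve `θ(f) = Γtr(εP) f` with constant term `1`. -/
theorem gber_nilExp (hε : IsNilpotentParameter ℬ N ε) (hθ : IsEulerDerivation ℬ ε θ)
    {l₀ : List (EvenDeg n)} (hl₀ : l₀.Nodup) (hl₀' : ∀ γ, γ ∈ l₀)
    {l₁ : List (OddDeg n)} (hl₁ : l₁.Nodup) (hl₁' : ∀ γ, γ ∈ l₁) {r : Deg n → ℕ}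
    {P : Matrix (BIdx r) (BIdx r) R} (hP : IsHom ℬ (fun i => i.1) (fun i => i.1) P)
    (hZ : (ε • P).map θ = ε • P) :
    gber l₀ l₁ (nilExp N (ε • P)) = nilExp N (gtr 0 (ε • P)) := by
  obtain ⟨⟨c, hc⟩, -, h⟩ := euler_gber hε hθ hl₀ hl₀' hl₁ hl₁' (IsUnip.nilExp hε hP)
  have hstr : gtr 0 (ε • P) = ε • gtr 0 P := by
    simp only [gtr_zero_eq_str, str, Finset.smul_sum]
    exact Finset.sum_congr rfl fun i _ => smul_comm _ ε _
  have hθstr : θ (ε • gtr 0 P) = ε • gtr 0 P := by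
    rw [← hstr, gtr_zero_eq_str]
    conv_rhs => rw [← hZ]
    simp only [str, map_sum, map_zsmul]
    rfl
  rw [logTr_nilExp hε hθ hP hZ, ← gtr_zero_eq_str, hstr] at h
  have h' := map_nilExp (N := N) θ hθ.leibniz hθstr
    (by rw [smul_pow, hε.pow_eq_zero, zero_smul])
  rw [hstr]
  refine eq_of_euler_eq (u := (c : R) - ∑ k ∈ Finset.range (N - 1),
      (((k + 1)! : ℝ)⁻¹) • (gtr 0 P * (ε • gtr 0 P) ^ k)) hθ hε.pow_eq_zero h h' ?_
  rw [hc, nilExp_eq_one_add hε.pow_eq_zero, smul_sub]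
  have : ((1 + ε * c : Subring.center R) : R) = 1 + ε • (c : R) := rfl
  rw [this, add_sub_add_left_eq_sub]

/-- The graded Liouville formula for any nilpotent parameter that admits an Euler derivation. -/
theorem gradedLiouville_of_euler (hε : IsNilpotentParameter ℬ N ε)
    (hθ : IsEulerDerivation ℬ ε θ)
    {l₀ : List (EvenDeg n)} (hl₀ : l₀.Nodup) (hl₀' : ∀ γ, γ ∈ l₀)
    {l₁ : List (OddDeg n)} (hl₁ : l₁.Nodup) (hl₁' : ∀ γ, γ ∈ l₁) {r : Deg n → ℕ}
    {P : Matrix (BIdx r) (BIdx r) R} (hP : IsHom ℬ (fun i => i.1) (fun i => i.1) P)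
    (hZ : (ε • P).map θ = ε • P) :
    IsGL0 ℬ (nilExp N (ε • P)) ∧ GberDefined l₀ l₁ (nilExp N (ε • P)) ∧
    gber l₀ l₁ (nilExp N (ε • P)) = nilExp N (gtr 0 (ε • P)) ∧
    ∀ (D₀ : Matrix (BIdx fun γ : EvenDeg n => r γ) (BIdx fun γ : EvenDeg n => r γ) R → R)
      (D₁ : Matrix (BIdx fun γ : OddDeg n => r γ) (BIdx fun γ : OddDeg n => r γ) R → R)
      (Ber : Matrix (BIdx r) (BIdx r) R → R),
      IsGradedDeterminant ℬ Subtype.val l₀ D₀ → IsGradedDeterminant ℬ Subtype.val l₁ D₁ →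
      IsGradedBerezinian ℬ D₀ D₁ Ber → Ber (nilExp N (ε • P)) = nilExp N (gtr 0 (ε • P)) := by
  have hE := IsUnip.nilExp hε hP
  have hber := gber_nilExp hε hθ hl₀ hl₀' hl₁ hl₁' hP hZ
  refine ⟨⟨(isHomogeneousMatrix_iff _ id _).2 (hE.isHom hε), hE.isUnit hε⟩,
    (euler_gber hε hθ hl₀ hl₀' hl₁ hl₁' hE).2.1, hber, fun D₀ D₁ Ber hD₀ hD₁ hBer => ?_⟩
  rw [hBer.eq_gber hε hl₀ hl₀' hl₁ hl₁' hD₀ hD₁ hE, hber]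

end Exponential

/-! ### The graded algebra `A[ε]` and the derivation `ε d/dε` -/

section NilPolyAlgebra

variable {A : Type*} [Ring A] (N : ℕ)

lemma mk_surjective :
    Function.Surjective (Ideal.Quotient.mk (Ideal.span {(Polynomial.X : A[X]) ^ N})) :=
  Ideal.Quotient.mk_surjective

lemma eps_pow_eq_zero : (eps N : NilPoly A N) ^ N = 0 := by
  rw [eps, ← map_pow]
  exact Ideal.Quotient.eq_zero_iff_mem.2 (Ideal.mem_span_singleton_self _)

/-- The parameter `ε` as an element of the center of `A[ε]`. -/
def epsCenter : Subring.center (NilPoly A N) :=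
  ⟨eps N, Subring.mem_center_iff.2 fun b => by
    obtain ⟨p, rfl⟩ := mk_surjective N b
    rw [eps, ← map_mul, ← map_mul, Polynomial.X_mul]⟩

lemma epsCenter_pow_eq_zero : (epsCenter N : Subring.center (NilPoly A N)) ^ N = 0 :=
  Subtype.ext (eps_pow_eq_zero N)

lemma commute_eps_pow (k : ℕ) (b : NilPoly A N) : Commute (eps N ^ k) b :=
  Commute.pow_left (Subring.mem_center_iff.1 (epsCenter N).2 b).symm k

/-- The operator `X d/dX` on polynomials. -/
def polyEuler (p : A[X]) : A[X] := Polynomial.X * Polynomial.derivative p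

lemma polyEuler_mul (p q : A[X]) : polyEuler (p * q) = polyEuler p * q + p * polyEuler q := by
  rw [polyEuler, polyEuler, polyEuler, Polynomial.derivative_mul, mul_add, ← mul_assoc,
    ← mul_assoc, Polynomial.X_mul (p := p), mul_assoc p]

lemma polyEuler_X_pow (k : ℕ) : polyEuler (Polynomial.X ^ k : A[X]) = k • Polynomial.X ^ k := by
  cases k with
  | zero => simp [polyEuler]
  | succ k =>
    rw [polyEuler, Polynomial.derivative_X_pow, Polynomial.X_mul, mul_assoc, add_tsub_cancel_right,
      ← pow_succ, nsmul_eq_mul]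
    simp

/-- `X d/dX` preserves the ideal `(X ^ N)`, as it maps `X ^ N` to `N X ^ N`. -/
lemma mk_polyEuler_congr {p q : A[X]}
    (h : (Ideal.Quotient.mk (Ideal.span {(Polynomial.X : A[X]) ^ N})) p =
      (Ideal.Quotient.mk (Ideal.span {(Polynomial.X : A[X]) ^ N})) q) :
    (Ideal.Quotient.mk (Ideal.span {(Polynomial.X : A[X]) ^ N})) (polyEuler p) =
      (Ideal.Quotient.mk (Ideal.span {(Polynomial.X : A[X]) ^ N})) (polyEuler q) := by
  obtain ⟨c, hc⟩ := Ideal.mem_span_singleton'.1 (Ideal.Quotient.eq.1 h)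
  refine Ideal.Quotient.eq.2 (Ideal.mem_span_singleton'.2 ⟨polyEuler c + N • c, ?_⟩)
  have h1 : polyEuler p - polyEuler q = polyEuler (p - q) := by
    rw [polyEuler, polyEuler, polyEuler, map_sub, mul_sub]
  rw [h1, ← hc, polyEuler_mul, polyEuler_X_pow, add_mul, smul_mul_assoc, mul_smul_comm]

variable [Algebra ℝ A]

lemma mk_smul (c : ℝ) (p : A[X]) :
    (Ideal.Quotient.mk (Ideal.span {(Polynomial.X : A[X]) ^ N})) (c • p) =
      c • (Ideal.Quotient.mk (Ideal.span {(Polynomial.X : A[X]) ^ N})) p := rfl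

/-- The operator `ε d/dε` on `A[ε]`. -/
def epsEuler : NilPoly A N →ₗ[ℝ] NilPoly A N where
  toFun b := Ideal.Quotient.mk _ (polyEuler (Function.surjInv (mk_surjective N) b))
  map_add' a b := by
    rw [← map_add, ← show polyEuler (_ + _) = polyEuler _ + polyEuler _ by
      rw [polyEuler, map_add, mul_add]; rfl]
    apply mk_polyEuler_congr
    rw [map_add]
    simp only [Function.surjInv_eq]
  map_smul' c a := by
    rw [RingHom.id_apply, ← mk_smul, ← show polyEuler (c • _) = c • polyEuler _ by
      rw [polyEuler, Polynomial.derivative_smul, mul_smul_comm]; rfl]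
    apply mk_polyEuler_congr
    rw [mk_smul]
    simp only [Function.surjInv_eq]

lemma epsEuler_mk (p : A[X]) : epsEuler N (Ideal.Quotient.mk _ p) =
    Ideal.Quotient.mk (Ideal.span {(Polynomial.X : A[X]) ^ N}) (polyEuler p) :=
  mk_polyEuler_congr N (Function.surjInv_eq (mk_surjective N) _)

lemma epsEuler_mul (a b : NilPoly A N) :
    epsEuler N (a * b) = epsEuler N a * b + a * epsEuler N b := by
  obtain ⟨p, rfl⟩ := mk_surjective N a
  obtain ⟨q, rfl⟩ := mk_surjective N b
  rw [← map_mul, epsEuler_mk, epsEuler_mk, epsEuler_mk, polyEuler_mul, map_add, map_mul, map_mul]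

lemma epsEuler_const_mul_eps_pow (a : A) (k : ℕ) :
    epsEuler N (const N a * eps N ^ k) = k • (const N a * eps N ^ k) := by
  have h : const N a * eps N ^ k = Ideal.Quotient.mk _ (Polynomial.C a * Polynomial.X ^ k) := by
    rw [map_mul, map_pow]
    rfl
  rw [h, epsEuler_mk, polyEuler_mul, polyEuler_X_pow, polyEuler, Polynomial.derivative_C, mul_zero,
    zero_mul, zero_add, mul_smul_comm, map_nsmul]

variable {n : ℕ} (𝒜 : Deg n → Submodule ℝ A)

lemma const_mul_eps_pow_mem {γ : Deg n} {a : A} (ha : a ∈ 𝒜 γ) (k : ℕ) :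
    const N a * eps N ^ k ∈ epsGrading N 𝒜 γ := Submodule.subset_span ⟨a, ha, k, rfl⟩

lemma const_mem {γ : Deg n} {a : A} (ha : a ∈ 𝒜 γ) : const N a ∈ epsGrading N 𝒜 γ := by
  simpa using const_mul_eps_pow_mem N 𝒜 ha 0

lemma const_mul_eps_pow_mul (a b : A) (k l : ℕ) :
    const N a * eps N ^ k * (const N b * eps N ^ l) = const N (a * b) * eps N ^ (k + l) := by
  rw [mul_assoc, ← mul_assoc (eps N ^ k), (commute_eps_pow N k _).eq, map_mul, pow_add, mul_assoc,
    mul_assoc]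

/-- Reduction of a property of pairs of homogeneous elements of `A[ε]`, linear in each of them, to
the generators `a εᵏ`. -/
lemma epsGrading_induction₂ {γ δ : Deg n} {p : NilPoly A N → NilPoly A N → Prop}
    (hgen : ∀ a ∈ 𝒜 γ, ∀ b ∈ 𝒜 δ, ∀ k l : ℕ, p (const N a * eps N ^ k) (const N b * eps N ^ l))
    (zero_left : ∀ y, p 0 y) (zero_right : ∀ x, p x 0)
    (add_left : ∀ x x' y, p x y → p x' y → p (x + x') y)
    (add_right : ∀ x y y', p x y → p x y' → p x (y + y'))
    (smul_left : ∀ (c : ℝ) x y, p x y → p (c • x) y)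
    (smul_right : ∀ (c : ℝ) x y, p x y → p x (c • y))
    {x y : NilPoly A N} (hx : x ∈ epsGrading N 𝒜 γ) (hy : y ∈ epsGrading N 𝒜 δ) : p x y := by
  induction hx, hy using Submodule.span_induction₂ with
  | mem_mem x y hx hy =>
    obtain ⟨a, ha, k, rfl⟩ := hx
    obtain ⟨b, hb, l, rfl⟩ := hy
    exact hgen a ha b hb k l
  | zero_left y _ => exact zero_left y
  | zero_right x _ => exact zero_right x
  | add_left x y z _ _ _ h h' => exact add_left _ _ _ h h'
  | add_right x y z _ _ _ h h' => exact add_right _ _ _ h h'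
  | smul_left c x y _ _ h => exact smul_left _ _ _ h
  | smul_right c x y _ _ h => exact smul_right _ _ _ h

instance epsGrading_gradedMonoid [SetLike.GradedMonoid 𝒜] :
    SetLike.GradedMonoid (epsGrading N 𝒜) where
  one_mem := by
    have := const_mem N 𝒜 (SetLike.GradedOne.one_mem (A := 𝒜))
    rwa [map_one] at this
  mul_mem γ δ x y hx hy := by
    refine epsGrading_induction₂ N 𝒜 (p := fun x y => x * y ∈ epsGrading N 𝒜 (γ + δ))
      (fun a ha b hb k l => ?_) ?_ ?_ ?_ ?_ ?_ ?_ hx hy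
    · rw [const_mul_eps_pow_mul]
      exact const_mul_eps_pow_mem N 𝒜 (SetLike.GradedMul.mul_mem ha hb) _
    · intro y
      rw [zero_mul]
      exact zero_mem _
    · intro x
      rw [mul_zero]
      exact zero_mem _
    · intro x x' y h h'
      rw [add_mul]
      exact add_mem h h'
    · intro x y y' h h'
      rw [mul_add]
      exact add_mem h h'
    · intro c x y h
      rw [smul_mul_assoc]
      exact Submodule.smul_mem _ _ h
    · intro c x y h
      rw [mul_smul_comm]
      exact Submodule.smul_mem _ _ h

lemma isGradedCommutative_epsGrading (hcomm : IsGradedCommutative 𝒜) :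
    IsGradedCommutative (epsGrading N 𝒜) := by
  intro γ δ x hx y hy
  refine epsGrading_induction₂ N 𝒜 (p := fun x y => y * x = sgn (sp γ δ) • (x * y))
    (fun a ha b hb k l => ?_) ?_ ?_ ?_ ?_ ?_ ?_ hx hy
  · rw [const_mul_eps_pow_mul, const_mul_eps_pow_mul, hcomm γ δ a ha b hb, map_zsmul,
      smul_mul_assoc, add_comm]
  · intro y
    rw [mul_zero, zero_mul, smul_zero]
  · intro x
    rw [mul_zero, zero_mul, smul_zero]
  · intro x x' y h h'
    rw [mul_add, add_mul, smul_add, h, h']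
  · intro x y y' h h'
    rw [mul_add, add_mul, smul_add, h, h']
  · intro c x y h
    rw [mul_smul_comm, smul_mul_assoc, h, smul_comm]
  · intro c x y h
    rw [mul_smul_comm, smul_mul_assoc, h, smul_comm]

/-- Elements of degree `0` commute with all homogeneous elements, which span the algebra. -/
lemma mem_center_of_mem_zero [GradedAlgebra 𝒜] (hcomm : IsGradedCommutative 𝒜) {a : A}
    (ha : a ∈ 𝒜 0) : a ∈ Subring.center A := by
  rw [Subring.mem_center_iff]
  intro b
  have hb : b ∈ ⨆ γ, 𝒜 γ := by
    rw [(DirectSum.Decomposition.isInternal 𝒜).submodule_iSup_eq_top]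
    exact Submodule.mem_top
  induction hb using Submodule.iSup_induction' with
  | mem γ b hb =>
    have : sp 0 γ = 0 := by simp [sp]
    rw [hcomm 0 γ a ha b hb, this]
    simp [sgn]
  | zero => rw [zero_mul, mul_zero]
  | add x y _ _ hx hy => rw [add_mul, mul_add, hx, hy]

lemma isNilpotentParameter_epsCenter [GradedAlgebra 𝒜] (hcomm : IsGradedCommutative 𝒜) :
    IsNilpotentParameter (epsGrading N 𝒜) N (epsCenter N) where
  comm := isGradedCommutative_epsGrading N 𝒜 hcomm
  central z hz := by
    change z ∈ (Subalgebra.center ℝ (NilPoly A N)).toSubmodule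
    refine Submodule.span_le.2 ?_ hz
    rintro _ ⟨a, ha, k, rfl⟩
    refine Subring.mem_center_iff.2 fun b => ?_
    have hk := commute_eps_pow N k b
    suffices h : Commute (const N a) b from (h.mul_left hk).eq.symm
    obtain ⟨p, rfl⟩ := mk_surjective N b
    refine Commute.map (f := Ideal.Quotient.mk _) (x := Polynomial.C a) (y := p) ?_
    have ha' := Subring.mem_center_iff.1 (mem_center_of_mem_zero 𝒜 hcomm ha)
    ext m
    rw [Polynomial.coeff_C_mul, Polynomial.coeff_mul_C, ha']
  mem := by
    have := const_mul_eps_pow_mem N 𝒜 (SetLike.GradedOne.one_mem (A := 𝒜)) 1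
    rwa [map_one, one_mul, pow_one] at this
  pow_eq_zero := epsCenter_pow_eq_zero N

lemma isEulerDerivation_epsEuler :
    IsEulerDerivation (epsGrading N 𝒜) (epsCenter N) (epsEuler N) where
  leibniz := epsEuler_mul N
  hom γ x hx := by
    suffices h : epsGrading N 𝒜 γ ≤ (epsGrading N 𝒜 γ).comap (epsEuler N) from h hx
    refine Submodule.span_le.2 ?_
    rintro _ ⟨a, ha, k, rfl⟩
    rw [SetLike.mem_coe, Submodule.mem_comap, epsEuler_const_mul_eps_pow]
    exact nsmul_mem (const_mul_eps_pow_mem N 𝒜 ha k) k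
  eps := by
    change epsEuler N (eps N) = eps N
    simpa using epsEuler_const_mul_eps_pow N (1 : A) 1
  dvd x := by
    obtain ⟨p, rfl⟩ := mk_surjective N x
    rw [epsEuler_mk]
    exact ⟨Ideal.Quotient.mk _ (Polynomial.derivative p), map_mul _ _ _⟩

/-- The matrix `X` with entries viewed in `A[ε]`. -/
def constMatrix {m : Type*} (X : Matrix m m A) : Matrix m m (NilPoly A N) := X.map (const N)

lemma epsMul_eq {m : Type*} (X : Matrix m m A) :
    epsMul N X = (epsCenter N : Subring.center (NilPoly A N)) • constMatrix N X := rfl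

lemma epsMul_map_epsEuler {m : Type*} (X : Matrix m m A) :
    (epsMul N X).map (epsEuler N) = epsMul N X := by
  ext i j
  have h := epsEuler_const_mul_eps_pow N (X i j) 1
  rw [one_smul, ← (commute_eps_pow N 1 _).eq, pow_one] at h
  exact h

end NilPolyAlgebra

end GradedLiouville

end

open GradedLiouville in
theorem theorem6p1 {n : ℕ} {A : Type*} [Ring A] [Algebra ℝ A]
    (𝒜 : Deg n → Submodule ℝ A) [GradedAlgebra 𝒜] (hcomm : IsGradedCommutative 𝒜)
    (l₀ : List (EvenDeg n)) (hl₀ : l₀.Nodup) (hl₀' : ∀ γ, γ ∈ l₀)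
    (l₁ : List (OddDeg n)) (hl₁ : l₁.Nodup) (hl₁' : ∀ γ, γ ∈ l₁)
    (N : ℕ) (r : Deg n → ℕ) (X : Matrix (BIdx r) (BIdx r) A)
    (hX : IsHomogeneousMatrix 𝒜 id 0 X) :
    IsGL0 (epsGrading N 𝒜) (nilExp N (epsMul N X)) ∧
    GberDefined l₀ l₁ (nilExp N (epsMul N X)) ∧
    gber l₀ l₁ (nilExp N (epsMul N X)) = nilExp N (gtr 0 (epsMul N X)) ∧
    ∀ (D₀ : Matrix (BIdx fun γ : EvenDeg n => r γ) (BIdx fun γ : EvenDeg n => r γ)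
          (NilPoly A N) → NilPoly A N)
      (D₁ : Matrix (BIdx fun γ : OddDeg n => r γ) (BIdx fun γ : OddDeg n => r γ)
          (NilPoly A N) → NilPoly A N)
      (Ber : Matrix (BIdx r) (BIdx r) (NilPoly A N) → NilPoly A N),
      IsGradedDeterminant (epsGrading N 𝒜) Subtype.val l₀ D₀ →
      IsGradedDeterminant (epsGrading N 𝒜) Subtype.val l₁ D₁ →
      IsGradedBerezinian (epsGrading N 𝒜) D₀ D₁ Ber →
      Ber (nilExp N (epsMul N X)) = nilExp N (gtr 0 (epsMul N X)) := by
  have hP : IsHom (epsGrading N 𝒜) (fun i : BIdx r => i.1) (fun i => i.1) (constMatrix N X) :=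
    fun i j => const_mem N 𝒜 ((isHomogeneousMatrix_iff 𝒜 id X).1 hX i j)
  have hZ := epsMul_map_epsEuler N X
  rw [epsMul_eq] at hZ ⊢
  exact gradedLiouville_of_euler (isNilpotentParameter_epsCenter N 𝒜 hcomm)
    (isEulerDerivation_epsEuler N 𝒜) hl₀ hl₀' hl₁ hl₁' hP hZ
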